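/- **Setting.** Let $\mathscr T$ be a finite rooted ordered binary tree (each vertex has at most two children) with edge set $E$, and let $d,n\ge 1$. The space of pre-shapes is $X=\prod_{e\in E}(\mathbb R^d)^n$; write $x=(x_e)_{e\in E}$, let $\|x_e\|$ be the Euclidean norm, and call $e$ collapsed in $x$ if $x_e=0$. Let $x\sim y$ if removing (collapsing) the collapsed edges of $x$ and of $y$ gives the same ordered attributed tree; that is, there is a bijection from $\{e: x_e\neq0\}$ to $\{e: y_e\ne 0\}$ that preserves and reflects the ancestor relation and the depth-first order, and preserves the attributes. The space of ordered tree-shapes is $\bar X=X/\!\sim$. For a metric $\delta$ on $X$ it carries the quotient distance $$\bar \delta(\bar x,\bar y)=\inf\Big\{\sum_{i=1}^k \delta(x_i,y_i)\ :\ k\ge 1,\ x_1\in\bar x,\ y_i\sim x_{i+1}\ (1\le i<k),\ y_k\in\bar y\Big\}.$$ The QED metric $\bar d_2$ is obtained from $d_2(x,y)=\big(\sum_{e}\|x_e-y_e\|^2\big)^{1/2}$, the TED metric $\bar d_1$ from $d_1(x,y)=\sum_{e}\|x_e-y_e\|$. Let $G$ be the group of reorderings of $\mathscr T$ (automorphisms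 of the underlying unordered rooted tree), acting on $X$ by permuting coordinates. The space of unordered tree-shapes $\bar{\bar X}=\bar X/G$ is the quotient of $\bar X$ by the equivalence relation generated by $\overline{x}\approx\overline{gx}$ ($x\in X$, $g\in G$), with the quotient distance $\bar{\bar d}_i$ induced by $\bar d_i$. *Restricted spaces.* Let $\mathcal E$ be a family of subsets of $E$ that contains with each $F$ all $F'\subseteq E$ of the same topology (collapsing all edges outside $F$, or all edges outside $F'$, gives the same ordered combinatorial tree). Put $Z=\bigcup_{F\in\mathcal E}\{x\in X: x_e=0 \text{ for } e\notin F\}$, with the metric and the equivalence relation restricted from $X$; $\bar Z=Z/\!\sim$, with the quotient distance formed within $Z$. If moreover $gF\in\mathcal E$ for all $F\in\mathcal E$, $g\in G$, let $\bar{\bar Z}=\bar Z/G$, with the quotient distance. *Averages.* In a metric space $S$: a *mean* of $x_1,\dots,x_s$ ($s\ge1$) is a minimizer over $S$ of $y\mapsto\sum_i \operatorname{dist}(y,x_i)^2$. A *circumcenter* of a non-empty set $Y\subseteq S$ is the center of a closed ball that contains $Y$ and whose radius is smallest among all closed balls containing $Y$. A *centroid* of one point is that point; a centroid of two points is the midpoint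 of a geodesic joining them; a centroid of $s\ge3$ points is a common limit of all entries of a sequence of $s$-tuples that starts with the given points and in which each next tuple consists of centroids of the $s$ subtuples of the previous one with one entry left out. **Theorem.** 1. *(QED)* Let $S$ be one of the spaces $\bar X,\bar{\bar X},\bar Z,\bar{\bar Z}$ with the QED metric. There is an open dense subset $O\subseteq S$ such that every $x\in O$ has a neighbourhood $U$ with the following properties: any two points of $U$ are joined by a unique geodesic of $S$, and it lies in $U$; all data points $x_1,\dots,x_s\in U$ ($s\ge1$) have a unique mean and a unique centroid in $S$, and these lie in $U$; every non-empty subset of $U$ has a unique circumcenter in $S$, and it lies in $U$. 2. *(TED)* Let $S$ be $\bar X$ or $\bar{\bar X}$ with the TED metric, where $|E|\ge 2$, or let $S$ be $\bar Z$ or $\bar{\bar Z}$ with the TED metric, where some $F\in\mathcal E$ has at least two elements. Then the averages are nowhere locally unique: for every $x\in S$ and every neighbourhood $U$ of $x$ there are points $a\neq b$ in $U$ such that the data set $\{a,b\}$ has at least two means in $U$, at least two centroids in $U$ and at least two circumcenters in $U$. -/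

import Mathlib

open Set Filter Topology
open scoped ENNReal

noncomputable section

namespace TreeShape

/-! ### Averages in (pseudo)metric spaces -/

section Averages

variable {S : Type*} [PseudoMetricSpace S]

/-- `m` is a Fréchet mean of the data set `x`: it minimizes the sum of squared distances to the
data points over the whole space. -/
def IsMean {n : ℕ} (x : Fin n → S) (m : S) : Prop :=
  ∀ y : S, ∑ i, dist m (x i) ^ 2 ≤ ∑ i, dist y (x i) ^ 2

/-- `c` is a circumcenter of `Y`: the center of a closed ball that contains `Y` and has the
smallest radius among all closed balls that contain `Y`. -/
def IsCircumcenter (Y : Set S) (c : S) : Prop :=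
  ∃ r : ℝ, Y ⊆ Metric.closedBall c r ∧
    ∀ (c' : S) (r' : ℝ), Y ⊆ Metric.closedBall c' r' → r ≤ r'

/-- `γ`, restricted to `[0, dist a b]`, is a geodesic (parametrized by arc length) from `a`
to `b`. -/
def IsGeodesic (a b : S) (γ : ℝ → S) : Prop :=
  γ 0 = a ∧ γ (dist a b) = b ∧
    ∀ t ∈ Icc 0 (dist a b), ∀ t' ∈ Icc 0 (dist a b), dist (γ t) (γ t') = |t - t'|

/-- Any two points of `U` are joined by exactly one geodesic of the ambient space, and this
geodesic stays in `U`. -/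
def UniquelyGeodesicOn (U : Set S) : Prop :=
  ∀ a ∈ U, ∀ b ∈ U, ∃ γ : ℝ → S, IsGeodesic a b γ ∧ (∀ t ∈ Icc 0 (dist a b), γ t ∈ U) ∧
    ∀ γ' : ℝ → S, IsGeodesic a b γ' → EqOn γ' γ (Icc 0 (dist a b))

/-- `c` is a centroid of the data points `x 0, …, x (n - 1)`. One point is its own centroid; a
centroid of two points is the midpoint of a geodesic joining them; for more points, one repeatedly
replaces the tuple by the tuple of the centroids of its subtuples with one entry left out, and all
entries of these tuples have to converge to `c`. -/
def IsCentroid : (n : ℕ) → (Fin n → S) → S → Prop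
  | 0, _, _ => False
  | 1, x, c => c = x 0
  | 2, x, c => ∃ γ : ℝ → S, IsGeodesic (x 0) (x 1) γ ∧ γ (dist (x 0) (x 1) / 2) = c
  | n + 3, x, c => ∃ t : ℕ → Fin (n + 3) → S, t 0 = x ∧
      (∀ k i, IsCentroid (n + 2) (fun j => t k (i.succAbove j)) (t (k + 1) i)) ∧
      ∀ i, Tendsto (fun k => t k i) atTop (𝓝 c)

/-- There is exactly one point of the space with the property `P`, and it lies in `U`. -/
def ExistsUniqueIn (U : Set S) (P : S → Prop) : Prop :=
  ∃ m ∈ U, P m ∧ ∀ m', P m' → m' = m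

variable (S) in
/-- A generic point of `S` (that is, each point of some open dense set) has a neighbourhood `U`
that is uniquely geodesic and such that every data set in `U` has a unique mean, a unique centroid
and a unique circumcenter. -/
def GenericallyUniqueAverages : Prop :=
  ∃ O : Set S, IsOpen O ∧ Dense O ∧ ∀ x ∈ O, ∃ U ∈ 𝓝 x,
    UniquelyGeodesicOn U ∧
    (∀ n : ℕ, 1 ≤ n → ∀ data : Fin n → S, (∀ i, data i ∈ U) →
      ExistsUniqueIn U (IsMean data) ∧ ExistsUniqueIn U (IsCentroid n data)) ∧
    ∀ Y : Set S, Y ⊆ U → Y.Nonempty → ExistsUniqueIn U (IsCircumcenter Y)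

variable (S) in
/-- Averages are nowhere locally unique in `S`: every neighbourhood of every point contains a
two-point data set that has several means, several centroids and several circumcenters, even
within this neighbourhood. -/
def NowhereUniqueAverages : Prop :=
  ∀ x : S, ∀ U ∈ 𝓝 x, ∃ a ∈ U, ∃ b ∈ U, a ≠ b ∧
    {m ∈ U | IsMean ![a, b] m}.Nontrivial ∧
    {c ∈ U | IsCentroid 2 ![a, b] c}.Nontrivial ∧
    {c ∈ U | IsCircumcenter {a, b} c}.Nontrivial

end Averages

/-! ### The quotient pseudometric -/

section QuotientMetric

variable {P : Type*} [PseudoMetricSpace P] (s : Setoid P)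

/-- The lengths `∑ dist (x i) (y i)` of the chains from `a` to `b`, where `x 0` represents `a`, the
point `y i` is equivalent to `x (i + 1)`, and the last `y i` represents `b`. -/
def chainLengths (a b : Quotient s) : Set ℝ :=
  {L | ∃ (k : ℕ) (x y : ℕ → P), Quotient.mk s (x 0) = a ∧ (∀ i < k, s (y i) (x (i + 1))) ∧
    Quotient.mk s (y k) = b ∧ L = ∑ i ∈ Finset.range (k + 1), dist (x i) (y i)}

/-- The quotient distance. -/
def quotientDist (a b : Quotient s) : ℝ := sInf (chainLengths s a b)

theorem chainLengths_nonneg {a b : Quotient s} {L : ℝ} (h : L ∈ chainLengths s a b) : 0 ≤ L := by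
  obtain ⟨k, x, y, -, -, -, rfl⟩ := h
  positivity

theorem chainLengths_bddBelow (a b : Quotient s) : BddBelow (chainLengths s a b) :=
  ⟨0, fun _ h => chainLengths_nonneg s h⟩

theorem chainLengths_nonempty (a b : Quotient s) : (chainLengths s a b).Nonempty := by
  induction a using Quotient.inductionOn with | _ a =>
  induction b using Quotient.inductionOn with | _ b =>
  exact ⟨_, 0, fun _ => a, fun _ => b, rfl, by simp, rfl, rfl⟩

theorem chainLengths_symm {a b : Quotient s} {L : ℝ} (h : L ∈ chainLengths s a b) :
    L ∈ chainLengths s b a := by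
  obtain ⟨k, x, y, hx, hxy, hy, rfl⟩ := h
  refine ⟨k, fun i => y (k - i), fun i => x (k - i), by simpa using hy, fun i hi => ?_,
    by simpa using hx, ?_⟩
  · have h := hxy (k - (i + 1)) (by omega)
    rw [show k - (i + 1) + 1 = k - i by omega] at h
    exact s.symm' h
  · rw [← Finset.sum_range_reflect (fun i => dist (x i) (y i)) (k + 1)]
    simp [dist_comm]

theorem chainLengths_add {a b c : Quotient s} {L M : ℝ} (h : L ∈ chainLengths s a b)
    (h' : M ∈ chainLengths s b c) : L + M ∈ chainLengths s a c := by
  obtain ⟨k, x, y, hx, hxy, hy, rfl⟩ := h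
  obtain ⟨l, z, w, hz, hzw, hw, rfl⟩ := h'
  refine ⟨k + 1 + l, fun i => if i ≤ k then x i else z (i - (k + 1)),
    fun i => if i ≤ k then y i else w (i - (k + 1)), by simpa using hx, fun i hi => ?_, ?_, ?_⟩
  · rcases lt_trichotomy i k with h | h | h
    · have h1 : i ≤ k := by omega
      have h2 : i + 1 ≤ k := by omega
      simpa [h1, h2] using hxy i h
    · subst h
      have : s (y i) (z 0) := Quotient.exact (hy.trans hz.symm)
      simpa using this
    · have h1 : ¬ i ≤ k := by omega
      have h2 : ¬ i + 1 ≤ k := by omega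
      have h3 := hzw (i - (k + 1)) (by omega)
      rw [show i - (k + 1) + 1 = i + 1 - (k + 1) by omega] at h3
      simpa only [h1, h2, if_false] using h3
  · have h1 : ¬ k + 1 + l ≤ k := by omega
    simpa [h1] using hw
  · rw [show k + 1 + l + 1 = (k + 1) + (l + 1) by omega, Finset.sum_range_add _ (k + 1) (l + 1)]
    refine congrArg₂ (fun u v : ℝ => u + v) ?_ ?_
    · refine Finset.sum_congr rfl fun i hi => ?_
      have h1 : i ≤ k := by have := Finset.mem_range.1 hi; omega
      simp [h1]
    · refine Finset.sum_congr rfl fun i _ => ?_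
      have h1 : ¬ k + 1 + i ≤ k := by omega
      simp [h1]

/-- The quotient pseudometric on the quotient of a (pseudo)metric space. -/
@[reducible] def quotientPseudoMetric : PseudoMetricSpace (Quotient s) where
  dist := quotientDist s
  dist_self a := by
    refine le_antisymm (csInf_le (chainLengths_bddBelow s a a) ?_)
      (Real.sInf_nonneg fun _ h => chainLengths_nonneg s h)
    induction a using Quotient.inductionOn with | _ a =>
    exact ⟨0, fun _ => a, fun _ => a, rfl, by simp, rfl, by simp⟩
  dist_comm a b := congrArg sInf
    (Set.ext fun _ => ⟨chainLengths_symm s, chainLengths_symm s⟩)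
  dist_triangle a b c := by
    refine le_of_forall_pos_le_add fun ε hε => ?_
    obtain ⟨L, hL, hL'⟩ := exists_lt_of_csInf_lt (chainLengths_nonempty s a b)
      (lt_add_of_pos_right _ (half_pos hε))
    obtain ⟨M, hM, hM'⟩ := exists_lt_of_csInf_lt (chainLengths_nonempty s b c)
      (lt_add_of_pos_right _ (half_pos hε))
    have := csInf_le (chainLengths_bddBelow s a c) (chainLengths_add s hL hM)
    simp only [quotientDist]
    linarith

end QuotientMetric

/-! ### Trees -/

/-- A finite rooted ordered binary tree. A vertex is encoded by the sequence of left
(`false`) / right (`true`) turns on the path from the root to it. -/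
structure OrderedBinaryTree where
  verts : Finset (List Bool)
  root_mem : [] ∈ verts
  parent_mem : ∀ (w : List Bool) (b : Bool), w ++ [b] ∈ verts → w ∈ verts

variable {T : OrderedBinaryTree}

/-- The edges of the tree; an edge is identified with its lower end, a vertex other than the
root. -/
abbrev OrderedBinaryTree.Edge (T : OrderedBinaryTree) : Type := ↥(T.verts.erase [])

/-- The edge `e` lies on the path from the root to the lower end of `f`. -/
def Anc (e f : T.Edge) : Prop := e.1 <+: f.1

/-- The depth-first order on the edges (the lexicographic order of words). -/
def DepthFirstLT (e f : T.Edge) : Prop := e.1 < f.1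

/-- The bijection `φ` between two sets of edges identifies the ordered trees that arise when all
other edges are collapsed. -/
def IsOrderedIso {F F' : Finset T.Edge} (φ : F ≃ F') : Prop :=
  ∀ e f : F, (Anc (φ e).1 (φ f).1 ↔ Anc e.1 f.1) ∧
    (DepthFirstLT (φ e).1 (φ f).1 ↔ DepthFirstLT e.1 f.1)

/-- Collapsing all edges outside `F`, or all edges outside `F'`, gives the same ordered
combinatorial tree. -/
def SameTopology (F F' : Finset T.Edge) : Prop := ∃ φ : F ≃ F', IsOrderedIso φ

/-- A reordering of the tree: a rearrangement of siblings that maps the tree onto itself, in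
other words an automorphism of the underlying unordered rooted tree. -/
abbrev Reordering (T : OrderedBinaryTree) : Type :=
  (Anc : T.Edge → T.Edge → Prop) ≃r (Anc : T.Edge → T.Edge → Prop)

/-! ### Pre-shapes and shapes -/

/-- The space `∏_e (ℝᵈ)ⁿ` of pre-shapes; each factor `(ℝᵈ)ⁿ` carries its Euclidean norm. The
metric is the sum of the edge distances for `p = 1`, and the square root of the sum of the squared
edge distances for `p = 2`. -/
abbrev PreShape (T : OrderedBinaryTree) (d n : ℕ) (p : ℝ≥0∞) : Type :=
  PiLp p fun _ : T.Edge => PiLp 2 fun _ : Fin n => EuclideanSpace ℝ (Fin d)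

variable {d n : ℕ} {p : ℝ≥0∞}

open scoped Classical in
/-- The set of edges that are not collapsed in `x`. -/
def nonCollapsed (x : PreShape T d n p) : Finset T.Edge := {e | x e ≠ 0}

/-- `x` and `y` represent the same ordered tree-shape: after removal of the edges with zero
attribute, the ordered attributed trees agree. -/
def SameShape (x y : PreShape T d n p) : Prop :=
  ∃ φ : nonCollapsed x ≃ nonCollapsed y, IsOrderedIso φ ∧ ∀ e, y (φ e).1 = x e.1

theorem sameShape_equivalence : Equivalence (SameShape (T := T) (d := d) (n := n) (p := p)) where
  refl x := ⟨Equiv.refl _, fun _ _ => ⟨Iff.rfl, Iff.rfl⟩, fun _ => rfl⟩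
  symm := by
    rintro x y ⟨φ, h, h'⟩
    refine ⟨φ.symm, fun e f => ?_, fun e => ?_⟩
    · have := h (φ.symm e) (φ.symm f)
      simp only [Equiv.apply_symm_apply] at this
      exact ⟨this.1.symm, this.2.symm⟩
    · have := h' (φ.symm e)
      simp only [Equiv.apply_symm_apply] at this
      exact this.symm
  trans := by
    rintro x y z ⟨φ, h, h'⟩ ⟨ψ, k, k'⟩
    exact ⟨φ.trans ψ, fun e f => ⟨(k _ _).1.trans (h e f).1, (k _ _).2.trans (h e f).2⟩,
      fun e => (k' _).trans (h' e)⟩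

/-- The equivalence of pre-shapes, restricted to a set `Z` of pre-shapes. -/
def shapeSetoid (Z : Set (PreShape T d n p)) : Setoid Z where
  r x y := SameShape x.1 y.1
  iseqv := ⟨fun _ => sameShape_equivalence.refl _, fun h => sameShape_equivalence.symm h,
    fun h h' => sameShape_equivalence.trans h h'⟩

/-- The space of ordered tree-shapes that are represented in `Z`. -/
def OrderedShape (Z : Set (PreShape T d n p)) : Type := Quotient (shapeSetoid Z)

instance [Fact (1 ≤ p)] (Z : Set (PreShape T d n p)) : PseudoMetricSpace (OrderedShape Z) :=
  quotientPseudoMetric (shapeSetoid Z)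

/-- The action of a reordering on pre-shapes. -/
def reorder (g : Reordering T) (x : PreShape T d n p) : PreShape T d n p :=
  WithLp.toLp p fun e => x (g.symm e)

/-- The equivalence relation on ordered tree-shapes generated by the reorderings. -/
def reorderSetoid (Z : Set (PreShape T d n p)) : Setoid (OrderedShape Z) :=
  Relation.EqvGen.setoid fun a b => ∃ (g : Reordering T) (x y : Z), y.1 = reorder g x.1 ∧
    Quotient.mk (shapeSetoid Z) x = a ∧ Quotient.mk (shapeSetoid Z) y = b

/-- The space of unordered tree-shapes that are represented in `Z`. -/
def UnorderedShape (Z : Set (PreShape T d n p)) : Type := Quotient (reorderSetoid Z)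

instance [Fact (1 ≤ p)] (Z : Set (PreShape T d n p)) : PseudoMetricSpace (UnorderedShape Z) :=
  quotientPseudoMetric (reorderSetoid Z)

/-- The restricted pre-shape space `Z = ⋃ Zᵢ` for a family of sets `Eᵢ` of non-collapsed edges,
where `Zᵢ` is the linear subspace of the pre-shapes that vanish outside `Eᵢ`. -/
def restrictedPreShapes (𝓔 : Set (Finset T.Edge)) : Set (PreShape T d n p) :=
  {x | ∃ F ∈ 𝓔, ∀ e, e ∉ F → x e = 0}

/-- With each set of edges, the family contains all sets of edges that represent the same
topology. -/
def ContainsAllRepresentations (𝓔 : Set (Finset T.Edge)) : Prop :=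
  ∀ F ∈ 𝓔, ∀ F', SameTopology F F' → F' ∈ 𝓔

/-- The family is saturated with respect to reorderings. -/
def ReorderingSaturated (𝓔 : Set (Finset T.Edge)) : Prop :=
  ∀ F ∈ 𝓔, ∀ g : Reordering T, F.map g.toEquiv.toEmbedding ∈ 𝓔

end TreeShape

end

/-! Near a generic shape, the shape space is isometric to a ball in a normed space: Euclidean for
QED, an ℓ¹-sum of Euclidean spaces for TED. Both claims are then local statements about such a ball.

Two pre-shapes have the same class exactly when a permutation of the edges, admissible on the
support, carries one to the other (`IsShapeQuotient`, valid for ordered and unordered shapes). Let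
`F` be a support none of whose admissible images can be enlarged within `𝓔`, and let all
`F`-coordinates of `a` have norm at least `M`. A pre-shape closer than `M` to an admissible
permutation of `a` can neither lose nor gain an edge, so the distance to these permutations,
truncated at `M`, is constant on classes. It is also 1-Lipschitz and so bounds the quotient distance
from below (`IsShapeQuotient.exists_dist_permute_le`). If moreover the attributes are pairwise
distinct, a nearby permutation must be trivial on `F`, and the quotient map is a local isometry on
the subspace of `F` (`IsShapeQuotient.exists_isLocalChart`). Such points are dense: represent a
shape on the largest possible `F` (`exists_isTopologicallyMaximal`) and perturb
(`exists_generic_near`).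

In a Euclidean chart, data close to the centre have the averages of Euclidean space, because
competitors outside the chart are too far away (`IsLocalChart.exists_isGoodNhd`). In an ℓ¹ chart
with two edges, the two ways around a small square are geodesics with different midpoints
(`IsLocalChart.exists_nonunique`). -/

namespace TreeShape

/-! ### Isometric charts -/

section Charts

variable {S V : Type*} [PseudoMetricSpace S] [NormedAddCommGroup V]

/-- `ι` maps the ball of radius `R` around `y` isometrically onto the ball around `ι y`. -/
structure IsLocalChart (ι : V → S) (y : V) (R : ℝ) : Prop where
  pos : 0 < R
  isom : ∀ a b : V, dist a y < R → dist b y < R → dist (ι a) (ι b) = dist a b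
  surj : ∀ s : S, dist s (ι y) < R → ∃ a, dist a y < R ∧ ι a = s

/-- A neighbourhood in which all averages exist uniquely. -/
def IsGoodNhd (U : Set S) : Prop :=
  UniquelyGeodesicOn U ∧
    (∀ n : ℕ, 1 ≤ n → ∀ data : Fin n → S, (∀ i, data i ∈ U) →
      ExistsUniqueIn U (IsMean data) ∧ ExistsUniqueIn U (IsCentroid n data)) ∧
    ∀ Y : Set S, Y ⊆ U → Y.Nonempty → ExistsUniqueIn U (IsCircumcenter Y)

/-- A neighbourhood of `p` is a neighbourhood of all points near `p`, so having a good neighbourhood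
is an open condition and only density is left to check. -/
theorem genericallyUniqueAverages_of_dense
    (h : ∀ x : S, ∀ ε > 0, ∃ p : S, dist p x < ε ∧ ∃ U ∈ 𝓝 p, IsGoodNhd U) :
    GenericallyUniqueAverages S := by
  refine ⟨{p | ∃ U ∈ 𝓝 p, IsGoodNhd U}, ?_, ?_, ?_⟩
  · rw [isOpen_iff_mem_nhds]
    rintro p ⟨U, hU, hgood⟩
    filter_upwards [eventually_mem_nhds_iff.2 hU] with q hq
    exact ⟨U, hq, hgood⟩
  · rw [Metric.dense_iff]
    intro x ε hε
    obtain ⟨p, hp, h'⟩ := h x ε hε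
    exact ⟨p, hp, h'⟩
  · rintro p ⟨U, hU, h1, h2, h3⟩
    exact ⟨U, hU, h1, h2, h3⟩

variable {ι : V → S} {y : V} {R : ℝ}

/-- `S` is only known to be pseudometric; inside a chart, distance zero still forces equality, which
makes limits there unique. -/
theorem IsLocalChart.eq_of_dist_eq_zero (h : IsLocalChart ι y R) {a : V} (ha : dist a y < R)
    {s : S} (hs : dist s (ι a) = 0) : s = ι a := by
  have hy : dist y y < R := by simpa using h.pos
  have : dist s (ι y) < R := by
    have := dist_triangle s (ι a) (ι y)
    rw [hs, h.isom a y ha hy] at this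
    linarith
  obtain ⟨b, hb, rfl⟩ := h.surj s this
  rw [h.isom b a hb ha, dist_eq_zero] at hs
  rw [hs]

theorem IsLocalChart.image_closedBall (h : IsLocalChart ι y R) {ρ : ℝ} (hρ : ρ < R) {s : S} :
    s ∈ Metric.closedBall (ι y) ρ ↔ ∃ a ∈ Metric.closedBall y ρ, ι a = s := by
  have hy : dist y y < R := by simpa using h.pos
  simp only [Metric.mem_closedBall]
  constructor
  · intro hs
    obtain ⟨a, ha, rfl⟩ := h.surj s (hs.trans_lt hρ)
    exact ⟨a, by rwa [h.isom a y ha hy] at hs, rfl⟩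
  · rintro ⟨a, ha, rfl⟩
    rwa [h.isom a y (ha.trans_lt hρ) hy]

end Charts

/-! ### Geodesics, means and centroids in a Euclidean chart -/

section HilbertCharts

variable {S V : Type*} [PseudoMetricSpace S] [NormedAddCommGroup V] [InnerProductSpace ℝ V]
  {ι : V → S} {y : V} {R : ℝ}

/-- A geodesic between points of the `ρ`-ball has length at most `2 * ρ`, so it stays within `3 * ρ
< R` of the centre and lifts to the chart. There strict convexity determines each of its points from
the distances to the two ends. -/
theorem IsLocalChart.uniquelyGeodesicOn (h : IsLocalChart ι y R) {ρ : ℝ} (hρ : 3 * ρ < R) :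
    UniquelyGeodesicOn (Metric.closedBall (ι y) ρ) := by
  intro s hs s' hs'
  have hρ0 : 0 ≤ ρ := dist_nonneg.trans hs
  have hρR : ρ < R := by linarith
  obtain ⟨a, ha, rfl⟩ := (h.image_closedBall hρR).1 hs
  obtain ⟨b, hb, rfl⟩ := (h.image_closedBall hρR).1 hs'
  have hy : dist y y < R := by simpa using h.pos
  have haR : dist a y < R := lt_of_le_of_lt ha hρR
  have hbR : dist b y < R := lt_of_le_of_lt hb hρR
  have hab := h.isom a b haR hbR
  have hmem : ∀ t ∈ Icc 0 (dist a b), AffineMap.lineMap a b (t / dist a b) ∈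
      Metric.closedBall y ρ := fun t ht =>
    (convex_closedBall y ρ).lineMap_mem ha hb
      ⟨div_nonneg ht.1 dist_nonneg, div_le_one_of_le₀ ht.2 dist_nonneg⟩
  have hend : AffineMap.lineMap a b (dist a b / dist a b) = b := by
    rcases eq_or_ne a b with rfl | hne
    · simp
    · rw [div_self (dist_ne_zero.2 hne), AffineMap.lineMap_apply_one]
  refine ⟨fun t => ι (AffineMap.lineMap a b (t / dist a b)), ⟨by simp, ?_, ?_⟩, ?_, ?_⟩
  · simp only [hab, hend]
  · intro t ht t' ht'
    rw [hab] at ht ht'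
    rw [h.isom _ _ (lt_of_le_of_lt (hmem t ht) hρR) (lt_of_le_of_lt (hmem t' ht') hρR),
      dist_lineMap_lineMap, Real.dist_eq, ← sub_div, abs_div, abs_of_nonneg dist_nonneg]
    rcases eq_or_ne (dist a b) 0 with h0 | h0
    · rw [h0] at ht ht'
      have h1 : t = 0 := le_antisymm ht.2 ht.1
      have h2 : t' = 0 := le_antisymm ht'.2 ht'.1
      simp [h1, h2]
    · field_simp
  · intro t ht
    rw [hab] at ht
    exact (h.image_closedBall hρR).2 ⟨_, hmem t ht, rfl⟩
  · rintro γ ⟨h0, h1, hγ⟩ t ht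
    rw [hab] at h1 hγ ht
    have hL : (0 : ℝ) ≤ dist a b := dist_nonneg
    have d0 := hγ t ht 0 ⟨le_rfl, hL⟩
    have d1 := hγ t ht (dist a b) ⟨hL, le_rfl⟩
    rw [h0, sub_zero, abs_of_nonneg ht.1] at d0
    rw [h1, abs_of_nonpos (by linarith [ht.2])] at d1
    have hR : dist (γ t) (ι y) < R := by
      have e1 := dist_triangle (γ t) (ι a) (ι y)
      rw [d0, h.isom a y haR hy] at e1
      have e2 := dist_triangle_right a b y
      have ha' : dist a y ≤ ρ := ha
      have hb' : dist b y ≤ ρ := hb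
      linarith [ht.2]
    obtain ⟨c, hc, hcγ⟩ := h.surj _ hR
    rw [← hcγ, h.isom _ _ hc haR] at d0
    rw [← hcγ, h.isom _ _ hc hbR] at d1
    rw [← hcγ]
    change ι c = ι _
    congr 1
    rcases hL.eq_or_lt with h0 | h0
    · rw [← h0] at ht ⊢
      have : dist c a = 0 := by rw [d0]; exact le_antisymm ht.2 ht.1
      simp [dist_eq_zero.1 this]
    · refine eq_lineMap_of_dist_eq_mul_of_dist_eq_mul ?_ ?_
      · rw [dist_comm, d0, div_mul_cancel₀ _ h0.ne']
      · rw [d1]; field_simp; ring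

/-- The arithmetic mean of a tuple. -/
noncomputable def average {n : ℕ} (x : Fin n → V) : V := (n : ℝ)⁻¹ • ∑ i, x i

theorem average_mem {n : ℕ} (hn : 1 ≤ n) {x : Fin n → V} {B : Set V} (hB : Convex ℝ B)
    (hx : ∀ i, x i ∈ B) : average x ∈ B := by
  rw [average, Finset.smul_sum]
  refine hB.sum_mem (fun _ _ => by positivity) ?_ fun i _ => hx i
  simp only [Finset.sum_const, Finset.card_univ, Fintype.card_fin, nsmul_eq_mul]
  exact mul_inv_cancel₀ (by positivity)

theorem sum_eq_smul_average {n : ℕ} (hn : 1 ≤ n) (x : Fin n → V) :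
    ∑ i, x i = (n : ℝ) • average x := by
  rw [average, smul_smul, mul_inv_cancel₀ (by positivity), one_smul]

theorem average_homothety {n : ℕ} (hn : 1 ≤ n) (x : Fin n → V) (q : ℝ) :
    average (fun i => average x + q • (x i - average x)) = average x := by
  have h1 := sum_eq_smul_average hn x
  generalize average x = m at h1 ⊢
  have h3 : (n : ℝ) ≠ 0 := by positivity
  rw [average, Finset.sum_add_distrib, ← Finset.smul_sum, Finset.sum_sub_distrib, h1]
  simp only [Finset.sum_const, Finset.card_univ, Fintype.card_fin,
    ← Nat.cast_smul_eq_nsmul ℝ, sub_self, smul_zero, add_zero]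
  rw [smul_smul, inv_mul_cancel₀ h3, one_smul]

/-- The cross terms cancel because the deviations from the average sum to zero. -/
theorem sum_dist_sq_eq {n : ℕ} (hn : 1 ≤ n) (x : Fin n → V) (z : V) :
    ∑ i, dist z (x i) ^ 2 = ∑ i, dist (average x) (x i) ^ 2 + n * dist z (average x) ^ 2 := by
  set m := average x with hm
  have key : ∀ i, dist z (x i) ^ 2 =
      dist m (x i) ^ 2 + dist z m ^ 2 + 2 * inner ℝ (z - m) (m - x i) := fun i => by
    rw [dist_eq_norm, dist_eq_norm, dist_eq_norm, ← sub_add_sub_cancel z m (x i),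
      norm_add_sq_real]
    ring
  have h0 : ∑ i, (m - x i) = 0 := by
    rw [Finset.sum_sub_distrib, sum_eq_smul_average hn x, ← hm]
    simp [Nat.cast_smul_eq_nsmul]
  rw [Finset.sum_congr rfl fun i _ => key i, Finset.sum_add_distrib, Finset.sum_add_distrib,
    ← Finset.mul_sum, ← inner_sum, h0]
  simp

theorem IsLocalChart.isMean_iff (h : IsLocalChart ι y R) {ρ : ℝ} (hρ : 4 * ρ ≤ R) (hρ0 : 0 < ρ)
    {n : ℕ} (hn : 1 ≤ n) {x : Fin n → V} (hx : ∀ i, x i ∈ Metric.closedBall y ρ) (s : S) :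
    IsMean (ι ∘ x) s ↔ s = ι (average x) := by
  have hy : dist y y < R := by simpa using h.pos
  have hxR : ∀ i, dist (x i) y < R := fun i => lt_of_le_of_lt (hx i) (by linarith)
  have hm : dist (average x) y ≤ ρ := average_mem hn (convex_closedBall y ρ) hx
  have hmR : dist (average x) y < R := hm.trans_lt (by linarith)
  have hval : ∀ z, dist z y < R → ∑ i, dist (ι z) ((ι ∘ x) i) ^ 2 = ∑ i, dist z (x i) ^ 2 :=
    fun z hz => Finset.sum_congr rfl fun i _ => by rw [Function.comp, h.isom z _ hz (hxR i)]
  -- A point outside the chart has distance at least `R - ρ ≥ 3 * ρ` from each data point, whereas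
  -- the average has distance at most `2 * ρ`.
  have hfar : ∀ s : S, ¬ dist s (ι y) < R →
      ∑ i, dist (ι (average x)) ((ι ∘ x) i) ^ 2 < ∑ i, dist s ((ι ∘ x) i) ^ 2 := by
    intro s hs
    have : Nonempty (Fin n) := ⟨⟨0, hn⟩⟩
    refine Finset.sum_lt_sum_of_nonempty Finset.univ_nonempty fun i _ => ?_
    have hxi : dist (x i) y ≤ ρ := hx i
    have e1 := dist_triangle s (ι (x i)) (ι y)
    rw [h.isom _ y (hxR i) hy] at e1
    have e2 := dist_triangle_right (average x) (x i) y
    rw [Function.comp, h.isom _ _ hmR (hxR i)]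
    exact pow_lt_pow_left₀ (by linarith) dist_nonneg two_ne_zero
  have hmean : IsMean (ι ∘ x) (ι (average x)) := by
    intro s
    by_cases hs : dist s (ι y) < R
    · obtain ⟨z, hz, rfl⟩ := h.surj s hs
      rw [hval _ hmR, hval _ hz, sum_dist_sq_eq hn x z]
      have : 0 ≤ (n : ℝ) * dist z (average x) ^ 2 := by positivity
      linarith
    · exact (hfar s hs).le
  constructor
  · intro hs
    have hs' := hs (ι (average x))
    by_cases hsR : dist s (ι y) < R
    · obtain ⟨z, hz, rfl⟩ := h.surj s hsR
      rw [hval _ hmR, hval _ hz, sum_dist_sq_eq hn x z] at hs'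
      have h2 : (n : ℝ) * dist z (average x) ^ 2 ≤ 0 := by linarith
      have h3 : dist z (average x) ^ 2 ≤ 0 := by
        have : (0 : ℝ) < n := by exact_mod_cast hn
        by_contra! h4
        exact absurd h2 (not_le.2 (mul_pos this h4))
      have h4 : dist z (average x) = 0 :=
        pow_eq_zero_iff two_ne_zero |>.1 (le_antisymm h3 (sq_nonneg _))
      rw [dist_eq_zero.1 h4]
    · exact absurd hs' (not_le.2 (hfar s hsR))
  · rintro rfl
    exact hmean

/-- One step of the centroid iteration, seen in the vector space, is a homothety about the average
with ratio `-1 / (n + 2)`. -/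
theorem average_succAbove {n : ℕ} (x : Fin (n + 3) → V) (i : Fin (n + 3)) :
    average (fun j => x (i.succAbove j)) - average x =
      (-((n : ℝ) + 2)⁻¹) • (x i - average x) := by
  have h1 := sum_eq_smul_average (by omega) x
  have h2 := sum_eq_smul_average (by omega) (fun j => x (i.succAbove j))
  rw [Fin.sum_univ_succAbove x i, h2] at h1
  push_cast at h1
  have h3 : (n : ℝ) + 2 ≠ 0 := by positivity
  have h4 : ((n : ℝ) + 2) • average (fun j => x (i.succAbove j)) =
      ((n : ℝ) + 3) • average x - x i := by rw [← h1]; abel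
  rw [← sub_eq_zero]
  refine (smul_eq_zero_iff_right h3).1 ?_
  rw [smul_sub, smul_sub, h4, smul_smul, mul_neg, mul_inv_cancel₀ h3]
  module

theorem IsLocalChart.isCentroid_iff (h : IsLocalChart ι y R) {ρ : ℝ} (hρ : 3 * ρ < R)
    (hρ0 : 0 < ρ) : ∀ {n : ℕ}, 1 ≤ n → ∀ {x : Fin n → V}, (∀ i, x i ∈ Metric.closedBall y ρ) →
    ∀ s : S, IsCentroid n (ι ∘ x) s ↔ s = ι (average x)
  | 0, h0, _, _, _ => absurd h0 (by omega)
  | 1, _, x, _, s => by simp [IsCentroid, average]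
  | 2, _, x, hx, s => by
    have hρR : ρ < R := by linarith
    have hmem : ∀ i, ι (x i) ∈ Metric.closedBall (ι y) ρ := fun i =>
      (h.image_closedBall hρR).2 ⟨_, hx i, rfl⟩
    have hxR : ∀ i, dist (x i) y < R := fun i => lt_of_le_of_lt (hx i) hρR
    obtain ⟨γ, hγ, hγU, huniq⟩ := h.uniquelyGeodesicOn hρ _ (hmem 0) _ (hmem 1)
    have hL := h.isom _ _ (hxR 0) (hxR 1)
    have hhalf : dist (ι (x 0)) (ι (x 1)) / 2 ∈ Icc 0 (dist (ι (x 0)) (ι (x 1))) := by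
      constructor <;> linarith [dist_nonneg (x := ι (x 0)) (y := ι (x 1))]
    have hmid : γ (dist (ι (x 0)) (ι (x 1)) / 2) = ι (average x) := by
      obtain ⟨c, hc, hcγ⟩ := (h.image_closedBall hρR).1 (hγU _ hhalf)
      obtain ⟨h0, h1, hγd⟩ := hγ
      have hL0 : (0 : ℝ) ≤ dist (x 0) (x 1) := dist_nonneg
      have hcR : dist c y < R := lt_of_le_of_lt hc hρR
      have d0 := hγd _ hhalf 0 ⟨le_rfl, dist_nonneg⟩
      have d1 := hγd _ hhalf _ ⟨dist_nonneg, le_rfl⟩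
      rw [h0, ← hcγ, h.isom _ _ hcR (hxR 0), hL, sub_zero, abs_of_nonneg (by linarith)] at d0
      rw [h1, ← hcγ, h.isom _ _ hcR (hxR 1), hL, abs_of_nonpos (by linarith)] at d1
      rw [← hcγ]
      congr 1
      have : c = AffineMap.lineMap (x 0) (x 1) (1 / 2 : ℝ) :=
        eq_lineMap_of_dist_eq_mul_of_dist_eq_mul (by rw [dist_comm, d0]; ring)
          (by rw [d1]; ring)
      rw [this, average, Fin.sum_univ_two, AffineMap.lineMap_apply_module]
      module
    constructor
    · rintro ⟨γ', hγ', rfl⟩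
      exact (huniq γ' hγ' hhalf).trans hmid
    · rintro rfl
      exact ⟨γ, hγ, hmid⟩
  | n + 3, _, x, hx, s => by
    have ih := @isCentroid_iff h ρ hρ hρ0 (n + 2) (by omega)
    have hρR : ρ < R := by linarith
    set m := average x with hm
    have hmB : m ∈ Metric.closedBall y ρ :=
      average_mem (by omega) (convex_closedBall y ρ) hx
    set q : ℝ := -((n : ℝ) + 2)⁻¹ with hq
    -- The only possible iteration in the chart: the average stays fixed and the deviations shrink
    -- by `|q| < 1` at each step.
    set u : ℕ → Fin (n + 3) → V := fun k i => m + q ^ k • (x i - m) with hu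
    have hu0 : u 0 = x := by funext i; simp [hu]
    have huavg : ∀ k, average (u k) = m := by
      intro k
      exact average_homothety (by omega) x (q ^ k)
    have hustep : ∀ k i, average (fun j => u k (i.succAbove j)) = u (k + 1) i := by
      intro k i
      have := average_succAbove (u k) i
      rw [huavg, ← hq, sub_eq_iff_eq_add] at this
      rw [this]
      simp only [hu, pow_succ]
      module
    have huB : ∀ k i, u k i ∈ Metric.closedBall y ρ := by
      intro k
      induction k with
      | zero => rw [hu0]; exact hx
      | succ k ihk =>
        intro i
        rw [← hustep]
        exact average_mem (by omega) (convex_closedBall y ρ) fun j => ihk _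
    have hqlt : |q| < 1 := by
      rw [hq, abs_neg, abs_of_pos (by positivity)]
      exact inv_lt_one_of_one_lt₀ (by linarith [(Nat.cast_nonneg n : (0:ℝ) ≤ n)])
    have hulim : ∀ i, Tendsto (fun k => u k i) atTop (𝓝 m) := by
      intro i
      have := ((tendsto_pow_atTop_nhds_zero_of_abs_lt_one hqlt).smul_const (x i - m)).const_add m
      simpa [hu] using this
    have hιlim : ∀ i, Tendsto (fun k => ι (u k i)) atTop (𝓝 (ι m)) := by
      intro i
      rw [tendsto_iff_dist_tendsto_zero]
      have := tendsto_iff_dist_tendsto_zero.1 (hulim i)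
      refine this.congr fun k => ?_
      exact (h.isom _ _ (lt_of_le_of_lt (huB k i) hρR) (lt_of_le_of_lt hmB hρR)).symm
    constructor
    · rintro ⟨t, ht0, hstep, hlim⟩
      have htu : ∀ k, t k = ι ∘ u k := by
        intro k
        induction k with
        | zero => rw [ht0, hu0]
        | succ k ihk =>
          funext i
          have h1 := hstep k i
          rw [ihk] at h1
          have h2 := (ih (x := fun j => u k (i.succAbove j)) (fun j => huB k _) _).1 h1
          rw [h2, hustep]
          rfl
      have h1 := hlim 0
      simp only [htu] at h1
      have h2 := Metric.inseparable_iff.1 (tendsto_nhds_unique_inseparable h1 (hιlim 0))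
      exact h.eq_of_dist_eq_zero (lt_of_le_of_lt hmB hρR) h2
    · rintro rfl
      refine ⟨fun k => ι ∘ u k, congrArg (ι ∘ ·) hu0, fun k i => ?_, hιlim⟩
      exact (ih (x := fun j => u k (i.succAbove j)) (fun j => huB k _) _).2 (by rw [hustep]; rfl)

end HilbertCharts

end TreeShape

namespace TreeShape

/-! ### Circumcenters in a Euclidean chart -/

section Circumcenters

variable {S V : Type*} [PseudoMetricSpace S] [NormedAddCommGroup V] [InnerProductSpace ℝ V]
  {ι : V → S} {y : V} {R : ℝ}

/-- Nearest-point projection onto `K` brings `c` no farther from any point of `K`. This confines the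
search for a circumcenter to a compact ball. -/
theorem exists_dist_le_of_convex {K : Set V} (hK : IsComplete K) (hne : K.Nonempty)
    (hconv : Convex ℝ K) (c : V) : ∃ c' ∈ K, ∀ z ∈ K, dist c' z ≤ dist c z := by
  obtain ⟨v, hv, hmin⟩ := exists_norm_eq_iInf_of_complete_convex hne hK hconv c
  refine ⟨v, hv, fun z hz => ?_⟩
  have h := (norm_eq_iInf_iff_real_inner_le_zero hconv hv).1 hmin z hz
  rw [dist_eq_norm, dist_eq_norm]
  refine le_of_sq_le_sq ?_ (norm_nonneg _)
  have e : c - z = (c - v) - (z - v) := by abel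
  rw [e, norm_sub_sq_real (c - v), norm_sub_rev v z]
  nlinarith [sq_nonneg ‖c - v‖]

/-- Compactness gives a centre; two centres at distance `δ` would, by the parallelogram law, allow a
smaller ball around their midpoint. -/
theorem exists_minimal_enclosing_ball [FiniteDimensional ℝ V] {ρ : ℝ} {Y : Set V}
    (hY : Y ⊆ Metric.closedBall y ρ) (hne : Y.Nonempty) :
    ∃ c ∈ Metric.closedBall y ρ, ∃ r : ℝ, Y ⊆ Metric.closedBall c r ∧
      (∀ c' r', Y ⊆ Metric.closedBall c' r' → r ≤ r') ∧
      ∀ c', Y ⊆ Metric.closedBall c' r → c' = c := by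
  have : ProperSpace V := FiniteDimensional.proper ℝ V
  obtain ⟨y₀, hy₀⟩ := hne
  have hne : Nonempty Y := ⟨⟨y₀, hy₀⟩⟩
  have hBne : (Metric.closedBall y ρ).Nonempty := ⟨y₀, hY hy₀⟩
  -- `f c` is the least radius of a ball around `c` that contains `Y`.
  set f : V → ℝ := fun c => ⨆ z : Y, dist c (z : V) with hf
  have hbdd : ∀ c, BddAbove (range fun z : Y => dist c (z : V)) := by
    intro c
    refine ⟨dist c y + ρ, ?_⟩
    rintro _ ⟨z, rfl⟩
    have h1 : dist (z : V) y ≤ ρ := hY z.2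
    have := dist_triangle_right c z y
    dsimp only
    linarith
  have hle : ∀ c (z : V), z ∈ Y → dist c z ≤ f c := fun c z hz =>
    le_ciSup (hbdd c) ⟨z, hz⟩
  have hfle : ∀ c r, Y ⊆ Metric.closedBall c r → f c ≤ r := fun c r h =>
    ciSup_le fun z => by
      rw [dist_comm]
      exact h z.2
  have hsub : ∀ c r, f c ≤ r → Y ⊆ Metric.closedBall c r := fun c r h z hz => by
    rw [Metric.mem_closedBall, dist_comm]
    exact (hle c z hz).trans h
  have hcont : Continuous f := by
    refine (LipschitzWith.of_le_add fun c c' => ?_).continuous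
    refine ciSup_le fun z => ?_
    linarith [dist_triangle c c' z, hle c' z z.2]
  obtain ⟨c, hc, hmin⟩ := (isCompact_closedBall y ρ).exists_isMinOn hBne hcont.continuousOn
  have hmin' : ∀ c', f c ≤ f c' := by
    intro c'
    obtain ⟨v, hv, hvd⟩ := exists_dist_le_of_convex (isCompact_closedBall y ρ).isComplete hBne
      (convex_closedBall y ρ) c'
    exact (show f c ≤ f v from hmin hv).trans (ciSup_le fun z => (hvd z (hY z.2)).trans (hle c' z z.2))
  refine ⟨c, hc, f c, hsub c _ le_rfl, fun c' r' h => (hmin' c').trans (hfle c' r' h), ?_⟩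
  intro c' hc'
  have hr0 : 0 ≤ f c := dist_nonneg.trans (hle c y₀ hy₀)
  set δ := dist c' c with hδ
  have hmid : f (midpoint ℝ c' c) ≤ √(f c ^ 2 - δ ^ 2 / 4) := by
    refine ciSup_le fun z => ?_
    refine Real.le_sqrt_of_sq_le ?_
    have h1 : dist c' z ≤ f c := (hle c' z z.2).trans (hfle c' _ hc')
    have h2 : dist c z ≤ f c := hle c z z.2
    have h3 := parallelogram_law_with_norm ℝ (c' - z) (c - z)
    have e1 : (c' - z) + (c - z) = (2 : ℝ) • (midpoint ℝ c' c - z) := by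
      rw [midpoint_eq_smul_add, smul_sub, smul_smul]
      norm_num
      module
    have e2 : (c' - z) - (c - z) = c' - c := by abel
    rw [e1, e2, norm_smul, ← dist_eq_norm, ← dist_eq_norm, ← dist_eq_norm, ← dist_eq_norm,
      ← hδ] at h3
    norm_num at h3
    have h4 := pow_le_pow_left₀ dist_nonneg h1 2
    have h5 := pow_le_pow_left₀ dist_nonneg h2 2
    nlinarith
  have h1 := (hmin' _).trans hmid
  have h2 : f c ^ 2 ≤ f c ^ 2 - δ ^ 2 / 4 := by
    -- For radius zero the square root of a negative number is `0` and the bound is void; then both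
    -- centres coincide with `y₀`.
    rcases hr0.eq_or_lt with h0 | h0
    · have h3 : dist c' y₀ ≤ f c := (hle c' y₀ hy₀).trans (hfle c' _ hc')
      have h4 : dist c y₀ ≤ f c := hle c y₀ hy₀
      have h5 := dist_triangle_right c' c y₀
      have h6 : δ = 0 := le_antisymm (by rw [hδ]; linarith) dist_nonneg
      rw [h6]
      simp
    · exact (Real.le_sqrt' h0).1 h1
  exact dist_eq_zero.1 (pow_eq_zero_iff two_ne_zero |>.1
    (le_antisymm (by linarith) (sq_nonneg δ)))

theorem IsLocalChart.existsUniqueIn_isCircumcenter [FiniteDimensional ℝ V]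
    (h : IsLocalChart ι y R) {ρ : ℝ} (hρ : 4 * ρ ≤ R) (hρ0 : 0 < ρ) {Y : Set S}
    (hY : Y ⊆ Metric.closedBall (ι y) ρ) (hne : Y.Nonempty) :
    ExistsUniqueIn (Metric.closedBall (ι y) ρ) (IsCircumcenter Y) := by
  have hy : dist y y < R := by simpa using h.pos
  have hρR : ρ < R := by linarith
  -- Only preimages in the small ball are taken, since nothing is known about `ι` outside the chart.
  set Y' : Set V := {a ∈ Metric.closedBall y ρ | ι a ∈ Y} with hY'
  have hlift : ∀ s ∈ Y, ∃ a ∈ Y', ι a = s := fun s hs => by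
    obtain ⟨a, ha, rfl⟩ := (h.image_closedBall hρR).1 (hY hs)
    exact ⟨a, ⟨ha, hs⟩, rfl⟩
  have hY'R : ∀ a ∈ Y', dist a y < R := fun a ha => lt_of_le_of_lt ha.1 hρR
  obtain ⟨s₀, hs₀⟩ := hne
  obtain ⟨y₀, hy₀, -⟩ := hlift s₀ hs₀
  obtain ⟨c, hc, r, hcr, hmin, huniq⟩ :=
    exists_minimal_enclosing_ball (Y := Y') (fun a ha => ha.1) ⟨y₀, hy₀⟩
  have hballs : ∀ c', dist c' y < R → ∀ r',
      Y ⊆ Metric.closedBall (ι c') r' ↔ Y' ⊆ Metric.closedBall c' r' := by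
    intro c' hc' r'
    constructor
    · intro hsub a ha
      have := hsub ha.2
      rwa [Metric.mem_closedBall, h.isom _ _ (hY'R a ha) hc'] at this
    · intro hsub s hs
      obtain ⟨a, ha, rfl⟩ := hlift s hs
      rw [Metric.mem_closedBall, h.isom _ _ (hY'R a ha) hc']
      exact hsub ha
  have hcR : dist c y < R := lt_of_le_of_lt hc hρR
  have hr : r ≤ 2 * ρ := by
    refine hmin y _ fun a ha => ?_
    have : dist a y ≤ ρ := ha.1
    rw [Metric.mem_closedBall]
    linarith
  -- Enclosing balls of radius below `3 * ρ` have their centre in the chart; larger ones lose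
  -- against `r ≤ 2 * ρ`.
  have hfar : ∀ s r', Y ⊆ Metric.closedBall s r' → r' < 3 * ρ → dist s (ι y) < R := by
    intro s r' hsub hr'
    have h1 : dist s₀ s ≤ r' := hsub hs₀
    have h2 : dist s₀ (ι y) ≤ ρ := hY hs₀
    have := dist_triangle_left s (ι y) s₀
    linarith
  refine ⟨ι c, (h.image_closedBall hρR).2 ⟨c, hc, rfl⟩, ⟨r, (hballs c hcR r).2 hcr, ?_⟩, ?_⟩
  · intro s r' hsub
    by_cases hr' : r' < 3 * ρ
    · obtain ⟨c', hc', rfl⟩ := h.surj s (hfar s r' hsub hr')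
      exact hmin c' r' ((hballs c' hc' r').1 hsub)
    · linarith
  · rintro s ⟨r₁, hsub, hr₁⟩
    have h1 := hr₁ (ι c) r ((hballs c hcR r).2 hcr)
    have hsub' : Y ⊆ Metric.closedBall s r := hsub.trans (Metric.closedBall_subset_closedBall h1)
    obtain ⟨c', hc', rfl⟩ := h.surj s (hfar s r hsub' (by linarith))
    rw [huniq c' ((hballs c' hc' r).1 hsub')]

theorem IsLocalChart.exists_isGoodNhd [FiniteDimensional ℝ V] (h : IsLocalChart ι y R) :
    ∃ U ∈ 𝓝 (ι y), IsGoodNhd U := by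
  have hR := h.pos
  have hρ0 : 0 < R / 4 := by linarith
  have hρR : R / 4 < R := by linarith
  refine ⟨Metric.closedBall (ι y) (R / 4), Metric.closedBall_mem_nhds _ hρ0,
    h.uniquelyGeodesicOn (by linarith), fun n hn data hdata => ?_,
    fun Y hY hne => h.existsUniqueIn_isCircumcenter (by linarith) hρ0 hY hne⟩
  choose x hx hxd using fun i => (h.image_closedBall hρR).1 (hdata i)
  obtain rfl : ι ∘ x = data := funext hxd
  have hmem := (h.image_closedBall hρR).2
    ⟨_, average_mem hn (convex_closedBall y (R / 4)) hx, rfl⟩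
  have h1 := h.isMean_iff (by linarith) hρ0 hn hx
  have h2 := h.isCentroid_iff (by linarith) hρ0 hn hx
  exact ⟨⟨_, hmem, (h1 _).2 rfl, fun _ h' => (h1 _).1 h'⟩,
    ⟨_, hmem, (h2 _).2 rfl, fun _ h' => (h2 _).1 h'⟩⟩

end Circumcenters

/-! ### Non-unique averages in an ℓ¹ chart -/

section Midpoints

variable {S : Type*} [PseudoMetricSpace S]

/-- By convexity of the square and the triangle inequality, the sum of squares is at least `dist a b
^ 2 / 2`, and a midpoint attains this. -/
theorem isMean_of_midpoint {a b m : S} (h1 : dist m a = dist a b / 2)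
    (h2 : dist m b = dist a b / 2) : IsMean ![a, b] m := by
  intro s
  have := dist_triangle_left a b s
  simp only [Fin.sum_univ_two, Matrix.cons_val_zero, Matrix.cons_val_one, h1, h2]
  nlinarith [sq_nonneg (dist s a - dist s b), dist_nonneg (x := a) (y := b),
    dist_nonneg (x := s) (y := a), dist_nonneg (x := s) (y := b)]

theorem isCircumcenter_of_midpoint {a b m : S} (h1 : dist m a = dist a b / 2)
    (h2 : dist m b = dist a b / 2) : IsCircumcenter {a, b} m := by
  refine ⟨dist a b / 2, ?_, fun s r hs => ?_⟩
  · rintro z (rfl | rfl)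
    · rw [Metric.mem_closedBall, dist_comm, h1]
    · rw [Metric.mem_closedBall, dist_comm, h2]
  · have ha : dist a s ≤ r := hs (by simp)
    have hb : dist b s ≤ r := hs (by simp)
    have := dist_triangle_right a b s
    linarith

variable {V : Type*} [NormedAddCommGroup V] [NormedSpace ℝ V] {ι : V → S} {y : V} {R : ℝ}

/-- The geodesic that first runs in direction `v` and then in direction `w`. -/
theorem IsLocalChart.isGeodesic_bent (h : IsLocalChart ι y R) {v w : V}
    (hvw : ∀ α β : ℝ, ‖α • v + β • w‖ = |α| + |β|) {t : ℝ} (ht : 0 ≤ t) (htR : 2 * t < R) :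
    IsGeodesic (ι y) (ι (y + (t • v + t • w)))
      (fun s => ι (y + (min s t • v + max (s - t) 0 • w))) := by
  have hnear : ∀ s ∈ Icc 0 (2 * t), dist (y + (min s t • v + max (s - t) 0 • w)) y < R := by
    intro s hs
    rw [dist_self_add_left, hvw]
    rcases le_total s t with h1 | h1
    · rw [min_eq_left h1, max_eq_right (by linarith), abs_of_nonneg hs.1]
      simp only [abs_zero, add_zero]
      linarith [hs.2]
    · rw [min_eq_right h1, max_eq_left (by linarith), abs_of_nonneg ht,
        abs_of_nonneg (by linarith)]
      linarith [hs.2]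
  have hy : dist y y < R := by simpa using h.pos
  have hb : dist (y + (t • v + t • w)) y < R := by
    rw [dist_self_add_left, hvw, abs_of_nonneg ht]
    linarith
  have hd : dist (ι y) (ι (y + (t • v + t • w))) = 2 * t := by
    rw [h.isom _ _ hy hb, dist_self_add_right, hvw, abs_of_nonneg ht]
    ring
  refine ⟨by simp [ht], ?_, ?_⟩
  · simp only [hd]
    rw [min_eq_right (by linarith), max_eq_left (by linarith)]
    congr 5
    ring
  -- Both coefficients are nondecreasing in the parameter, so their increments add up to the
  -- parameter difference in the ℓ¹ norm.
  · rw [hd]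
    intro s hs s' hs'
    rw [h.isom _ _ (hnear s hs) (hnear s' hs'), dist_add_left, dist_eq_norm, add_sub_add_comm,
      ← sub_smul, ← sub_smul, hvw]
    rcases le_total s t with h1 | h1 <;> rcases le_total s' t with h2 | h2
    · simp [h1, h2]
    · rw [min_eq_left h1, min_eq_right h2, max_eq_right (by linarith), max_eq_left (by linarith),
        abs_of_nonpos (by linarith), abs_of_nonpos (by linarith), abs_of_nonpos (by linarith)]
      ring
    · rw [min_eq_right h1, min_eq_left h2, max_eq_left (by linarith), max_eq_right (by linarith),
        abs_of_nonneg (by linarith), abs_of_nonneg (by linarith), abs_of_nonneg (by linarith)]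
      ring
    · rw [min_eq_right h1, min_eq_right h2, max_eq_left (by linarith), max_eq_left (by linarith)]
      simp

/-- The vectors `v` and `w` span an ℓ¹ plane. Going along `v` then `w`, or `w` then `v`, gives two
geodesics with midpoints `ι (y + t • v)` and `ι (y + t • w)`, at distance `2 * t`. -/
theorem IsLocalChart.exists_nonunique (h : IsLocalChart ι y R) {v w : V}
    (hvw : ∀ α β : ℝ, ‖α • v + β • w‖ = |α| + |β|) {U : Set S} (hU : U ∈ 𝓝 (ι y)) :
    ∃ a ∈ U, ∃ b ∈ U, a ≠ b ∧
      {m ∈ U | IsMean ![a, b] m}.Nontrivial ∧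
      {c ∈ U | IsCentroid 2 ![a, b] c}.Nontrivial ∧
      {c ∈ U | IsCircumcenter {a, b} c}.Nontrivial := by
  obtain ⟨ε, hε, hεU⟩ := Metric.mem_nhds_iff.1 hU
  have hR := h.pos
  obtain ⟨t, ht, htm⟩ := exists_between (show (0 : ℝ) < min R ε / 2 by positivity)
  have htR : 2 * t < R := by linarith [min_le_left R ε]
  have htε : 2 * t < ε := by linarith [min_le_right R ε]
  have hy : dist y y < R := by simpa using hR
  have hwv : ∀ α β : ℝ, ‖α • w + β • v‖ = |α| + |β| := fun α β => by
    rw [add_comm, hvw, add_comm]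
  have hdist : ∀ α β : ℝ, dist (y + (α • v + β • w)) y = |α| + |β| := fun α β => by
    rw [dist_self_add_left, hvw]
  have hU' : ∀ α β : ℝ, |α| + |β| ≤ 2 * t → ι (y + (α • v + β • w)) ∈ U := fun α β hαβ =>
    hεU (by
      rw [Metric.mem_ball, h.isom _ _ (by rw [hdist]; linarith) hy, hdist]
      linarith)
  have hd : dist (ι y) (ι (y + (t • v + t • w))) = 2 * t := by
    rw [dist_comm, h.isom _ _ (by rw [hdist, abs_of_pos ht]; linarith) hy, hdist, abs_of_pos ht]
    ring
  have g1 := h.isGeodesic_bent hvw ht.le htR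
  have g2 := h.isGeodesic_bent hwv ht.le htR
  rw [add_comm (t • w)] at g2
  set a := ι y with ha
  set b := ι (y + (t • v + t • w)) with hb
  have hmid : ∀ {γ : ℝ → S}, IsGeodesic a b γ →
      dist (γ t) a = dist a b / 2 ∧ dist (γ t) b = dist a b / 2 := by
    rintro γ ⟨h0, h1, hγ⟩
    rw [hd] at hγ h1 ⊢
    have e0 := hγ t ⟨ht.le, by linarith⟩ 0 ⟨le_rfl, by linarith⟩
    have e1 := hγ t ⟨ht.le, by linarith⟩ (2 * t) ⟨by linarith, le_rfl⟩
    rw [h0, sub_zero, abs_of_pos ht] at e0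
    rw [h1, abs_of_nonpos (by linarith)] at e1
    exact ⟨by linarith, by linarith⟩
  have hcent : ∀ {γ : ℝ → S}, IsGeodesic a b γ → IsCentroid 2 ![a, b] (γ t) := by
    intro γ hγ
    refine ⟨γ, hγ, ?_⟩
    simp only [Matrix.cons_val_zero, Matrix.cons_val_one, hd]
    congr 1
    ring
  -- This unsimplified form is the bent geodesic evaluated at half its length `2 * t`.
  have hm1U : ι (y + (min t t • v + max (t - t) 0 • w)) ∈ U :=
    hU' _ _ (by simp [abs_of_pos ht]; linarith)
  have hm2U : ι (y + (min t t • w + max (t - t) 0 • v)) ∈ U := by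
    rw [add_comm (min t t • w)]
    exact hU' _ _ (by simp [abs_of_pos ht]; linarith)
  have hne : ι (y + (min t t • v + max (t - t) 0 • w)) ≠
      ι (y + (min t t • w + max (t - t) 0 • v)) := by
    intro heq
    have h0 := (congrArg (dist · _) heq).trans (dist_self _)
    rw [add_comm (min t t • w), h.isom _ _ (by rw [hdist]; simp [abs_of_pos ht]; linarith)
      (by rw [hdist]; simp [abs_of_pos ht]; linarith), dist_add_left, dist_eq_norm,
      add_sub_add_comm, ← sub_smul, ← sub_smul, hvw] at h0
    simp [abs_of_pos ht] at h0
    linarith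
  refine ⟨a, mem_of_mem_nhds hU, b, hU' t t (by rw [abs_of_pos ht]; linarith), ?_,
    ⟨_, ⟨hm1U, isMean_of_midpoint (hmid g1).1 (hmid g1).2⟩,
      _, ⟨hm2U, isMean_of_midpoint (hmid g2).1 (hmid g2).2⟩, hne⟩,
    ⟨_, ⟨hm1U, hcent g1⟩, _, ⟨hm2U, hcent g2⟩, hne⟩,
    ⟨_, ⟨hm1U, isCircumcenter_of_midpoint (hmid g1).1 (hmid g1).2⟩,
      _, ⟨hm2U, isCircumcenter_of_midpoint (hmid g2).1 (hmid g2).2⟩, hne⟩⟩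
  intro hab
  rw [hab, dist_self] at hd
  linarith

end Midpoints

end TreeShape

namespace TreeShape

/-! ### Metric quotients through nonexpansive functions -/

section QuotientMaps

/-- `π` is a metric quotient map: it is surjective and nonexpansive, and every nonexpansive
real-valued function that is constant on its fibres is nonexpansive on the quotient. -/
structure IsMetricQuotientMap {P S : Type*} [PseudoMetricSpace P] [PseudoMetricSpace S]
    (π : P → S) : Prop where
  surj : Function.Surjective π
  dist_le : ∀ x y, dist (π x) (π y) ≤ dist x y
  desc : ∀ g : P → ℝ, (∀ x y, π x = π y → g x = g y) → (∀ x y, g x ≤ g y + dist x y) →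
    ∀ x y, g x ≤ g y + dist (π x) (π y)

variable {P : Type*} [PseudoMetricSpace P] (s : Setoid P)

/-- Along a chain, `g` changes by at most the length of each hop and not at all at the
identifications. -/
theorem le_add_quotientDist {g : P → ℝ} (hinv : ∀ x y, s x y → g x = g y)
    (hlip : ∀ x y, g x ≤ g y + dist x y) (a b : P) :
    g a ≤ g b + quotientDist s (Quotient.mk s a) (Quotient.mk s b) := by
  rw [← sub_le_iff_le_add']
  refine le_csInf (chainLengths_nonempty s _ _) ?_
  rintro L ⟨k, x, y, hx, hxy, hy, rfl⟩
  rw [sub_le_iff_le_add', ← hinv _ _ (Quotient.exact hx), ← hinv _ _ (Quotient.exact hy)]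
  clear hx hy
  induction k with
  | zero => simpa using hlip (x 0) (y 0)
  | succ k ih =>
    have h1 := ih fun i hi => hxy i (by omega)
    have h2 := hinv _ _ (hxy k (by omega))
    have h3 := hlip (x (k + 1)) (y (k + 1))
    rw [Finset.sum_range_succ]
    linarith

theorem quotientDist_mk_le (x y : P) :
    quotientDist s (Quotient.mk s x) (Quotient.mk s y) ≤ dist x y :=
  csInf_le (chainLengths_bddBelow s _ _)
    ⟨0, fun _ => x, fun _ => y, rfl, by simp, rfl, by simp⟩

theorem isMetricQuotientMap_mk :
    letI := quotientPseudoMetric s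
    IsMetricQuotientMap (Quotient.mk s) :=
  letI := quotientPseudoMetric s
  { surj := Quotient.mk_surjective
    dist_le := quotientDist_mk_le s
    desc := fun _ hinv hlip => le_add_quotientDist s (fun _ _ h => hinv _ _ (Quotient.sound h)) hlip }

/-- A function constant on the fibres of the composite descends in two stages. Unordered shapes thus
become a quotient of pre-shapes without any handling of chains of chains. -/
theorem IsMetricQuotientMap.comp {P S S' : Type*} [PseudoMetricSpace P] [PseudoMetricSpace S]
    [PseudoMetricSpace S'] {π' : S → S'} {π : P → S} (h' : IsMetricQuotientMap π')
    (h : IsMetricQuotientMap π) : IsMetricQuotientMap (π' ∘ π) where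
  surj := h'.surj.comp h.surj
  dist_le x y := (h'.dist_le _ _).trans (h.dist_le x y)
  desc g hinv hlip x y := by
    have hg := h.desc g (fun x y hxy => hinv x y (congrArg π' hxy)) hlip
    set r := Function.surjInv h.surj with hr
    have hπr : ∀ s, π (r s) = s := Function.surjInv_eq h.surj
    have hgr : ∀ x, g (r (π x)) = g x := fun x =>
      hinv _ _ (congrArg π' (hπr _))
    have := h'.desc (fun s => g (r s))
      (fun a b hab => hinv _ _ (by simpa only [Function.comp, hπr] using hab))
      (fun a b => by simpa only [hπr] using hg (r a) (r b)) (π x) (π y)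
    rw [hgr, hgr] at this
    exact this

end QuotientMaps

/-! ### Local isometric charts of shape spaces -/

section Shapes

variable {T : OrderedBinaryTree} {d n : ℕ} {p : ℝ≥0∞}

/-- Permutation of the coordinates of a pre-shape. -/
noncomputable def permute (σ : Equiv.Perm T.Edge) (x : PreShape T d n p) : PreShape T d n p :=
  WithLp.toLp p fun e => x (σ.symm e)

@[simp] theorem permute_apply (σ : Equiv.Perm T.Edge) (x : PreShape T d n p) (e : T.Edge) :
    permute σ x e = x (σ.symm e) := rfl

theorem permute_mul (σ τ : Equiv.Perm T.Edge) (x : PreShape T d n p) :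
    permute (τ * σ) x = permute τ (permute σ x) := rfl

theorem permute_one (x : PreShape T d n p) : permute 1 x = x := rfl

theorem permute_symm_permute (σ : Equiv.Perm T.Edge) (x : PreShape T d n p) :
    permute σ.symm (permute σ x) = x := by
  ext e : 1
  simp

theorem permute_permute_symm (σ : Equiv.Perm T.Edge) (x : PreShape T d n p) :
    permute σ (permute σ.symm x) = x := by
  ext e : 1
  simp

theorem dist_permute [Fact (1 ≤ p)] (σ : Equiv.Perm T.Edge) (x y : PreShape T d n p) :
    dist (permute σ x) (permute σ y) = dist x y :=
  (LinearIsometryEquiv.piLpCongrLeft p ℝ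
    (PiLp 2 fun _ : Fin n => EuclideanSpace ℝ (Fin d)) σ).isometry.dist_eq x y

theorem dist_apply_le [Fact (1 ≤ p)] (x y : PreShape T d n p) (e : T.Edge) :
    dist (x e) (y e) ≤ dist x y := by
  rw [dist_eq_norm, dist_eq_norm]
  exact PiLp.norm_apply_le (x - y) e

theorem mem_nonCollapsed {x : PreShape T d n p} {e : T.Edge} : e ∈ nonCollapsed x ↔ x e ≠ 0 := by
  simp [nonCollapsed]

theorem nonCollapsed_permute (σ : Equiv.Perm T.Edge) (x : PreShape T d n p) :
    nonCollapsed (permute σ x) = (nonCollapsed x).map σ.toEmbedding := by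
  ext e
  simp [mem_nonCollapsed, Finset.mem_map_equiv]

theorem mem_restrictedPreShapes {𝓔 : Set (Finset T.Edge)} {x : PreShape T d n p} :
    x ∈ restrictedPreShapes 𝓔 ↔ ∃ F ∈ 𝓔, nonCollapsed x ⊆ F := by
  refine exists_congr fun F => and_congr_right fun _ => forall_congr' fun e => ?_
  rw [mem_nonCollapsed]
  exact not_imp_comm

/-- The pre-shapes that vanish outside `F`. -/
def supportedOn (T : OrderedBinaryTree) (d n : ℕ) (p : ℝ≥0∞) (F : Finset T.Edge) :
    Submodule ℝ (PreShape T d n p) where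
  carrier := {x | ∀ e, e ∉ F → x e = 0}
  add_mem' hx hy e he := by simp [hx e he, hy e he]
  zero_mem' _ _ := rfl
  smul_mem' _ _ hx e he := by simp [hx e he]

theorem permute_mem_supportedOn {F : Finset T.Edge} {x : PreShape T d n p}
    (hx : x ∈ supportedOn T d n p F) (σ : Equiv.Perm T.Edge) :
    permute σ x ∈ supportedOn T d n p (F.map σ.toEmbedding) := fun _ he =>
  hx _ fun h => he (Finset.mem_map_equiv.2 h)

theorem mem_restrictedPreShapes_of_mem_supportedOn {𝓔 : Set (Finset T.Edge)} {F : Finset T.Edge}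
    (hF : F ∈ 𝓔) {x : PreShape T d n p} (hx : x ∈ supportedOn T d n p F) :
    x ∈ restrictedPreShapes 𝓔 := ⟨F, hF, hx⟩

/-- The points of `S` are classes of pre-shapes in `⋃_{F ∈ 𝓔} supportedOn F`, where two pre-shapes
are identified if they differ by a permutation of the edges that is admissible on the support. -/
structure IsShapeQuotient [Fact (1 ≤ p)] {S : Type*} [PseudoMetricSpace S]
    (𝓔 : Set (Finset T.Edge)) (Adm : Finset T.Edge → Equiv.Perm T.Edge → Prop)
    (π : ↥(restrictedPreShapes 𝓔 : Set (PreShape T d n p)) → S) : Prop where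
  quot : IsMetricQuotientMap π
  refl : ∀ F, Adm F 1
  trans : ∀ F σ τ, Adm F σ → Adm (F.map σ.toEmbedding) τ → Adm F (τ * σ)
  closed : ∀ F ∈ 𝓔, ∀ σ, Adm F σ → F.map σ.toEmbedding ∈ 𝓔
  exact : ∀ z w, π z = π w → ∃ σ, Adm (nonCollapsed z.1) σ ∧ w.1 = permute σ z.1
  sound : ∀ F ∈ 𝓔, ∀ σ, Adm F σ → ∀ z w, z.1 ∈ supportedOn T d n p F → w.1 = permute σ z.1 →
    π z = π w

variable [Fact (1 ≤ p)] {S : Type*} [PseudoMetricSpace S]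
  {𝓔 : Set (Finset T.Edge)} {Adm : Finset T.Edge → Equiv.Perm T.Edge → Prop}
  {π : ↥(restrictedPreShapes 𝓔 : Set (PreShape T d n p)) → S}

/-- No set of edges in `𝓔` is strictly larger than an admissible image of `F`. -/
def IsTopologicallyMaximal (𝓔 : Set (Finset T.Edge))
    (Adm : Finset T.Edge → Equiv.Perm T.Edge → Prop) (F : Finset T.Edge) : Prop :=
  ∀ σ, Adm F σ → ∀ F' ∈ 𝓔, F.map σ.toEmbedding ⊆ F' → F' = F.map σ.toEmbedding

/-- Closeness keeps every edge of the image of `F` from collapsing, and maximality leaves no room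
for further edges. -/
theorem nonCollapsed_eq_of_dist_lt {F : Finset T.Edge} (hmax : IsTopologicallyMaximal 𝓔 Adm F)
    {a z : PreShape T d n p} {M : ℝ} (haM : ∀ e ∈ F, M ≤ ‖a e‖) (hz : z ∈ restrictedPreShapes 𝓔)
    {σ : Equiv.Perm T.Edge} (hσ : Adm F σ) (hd : dist (permute σ a) z < M) :
    nonCollapsed z = F.map σ.toEmbedding := by
  obtain ⟨F', hF', hzF'⟩ := mem_restrictedPreShapes.1 hz
  have hsub : F.map σ.toEmbedding ⊆ nonCollapsed z := by
    intro e he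
    rw [Finset.mem_map_equiv] at he
    rw [mem_nonCollapsed]
    intro h0
    have h1 := (dist_apply_le (permute σ a) z e).trans_lt hd
    rw [h0, dist_zero_right, permute_apply] at h1
    exact absurd (haM _ he) (not_le.2 h1)
  have := hmax σ hσ F' hF' (hsub.trans hzF')
  exact (this ▸ hzF').antisymm hsub

/-- The truncated distance to the finite orbit of `a` descends to the quotient. It vanishes at `a`,
hence is bounded by the quotient distance from `a`; below `M` the truncation is inactive. -/
theorem IsShapeQuotient.exists_dist_permute_le (h : IsShapeQuotient 𝓔 Adm π) {F : Finset T.Edge}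
    (hmax : IsTopologicallyMaximal 𝓔 Adm F) {a z : ↥(restrictedPreShapes 𝓔 : Set (PreShape T d n p))}
    {M : ℝ} (haM : ∀ e ∈ F, M ≤ ‖a.1 e‖) (hd : dist (π a) (π z) < M) :
    ∃ σ, Adm F σ ∧ dist (permute σ a.1) z.1 ≤ dist (π a) (π z) := by
  set Orb : Set (PreShape T d n p) := (fun σ => permute σ a.1) '' {σ | Adm F σ} with hOrb
  have hfin : Orb.Finite := (Set.toFinite _).image _
  have hne : Orb.Nonempty := ⟨_, 1, h.refl F, rfl⟩
  have hatt : ∀ z, ∃ σ, Adm F σ ∧ Metric.infDist z Orb = dist (permute σ a.1) z := by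
    intro z
    obtain ⟨_, ⟨σ, hσ, rfl⟩, hz⟩ := hfin.isCompact.exists_infDist_eq_dist hne z
    exact ⟨σ, hσ, by rw [hz, dist_comm]⟩
  -- Where the truncation is inactive, `z` has support exactly `F.map σ`, so the permutation taking
  -- `z` to `w` composes with `σ` and moves the nearest orbit point along.
  have hmono : ∀ z w, π z = π w → min M (Metric.infDist w.1 Orb) ≤ min M (Metric.infDist z.1 Orb) := by
    intro z w hzw
    rcases le_or_gt M (Metric.infDist z.1 Orb) with h1 | h1
    · rw [min_eq_left h1]
      exact min_le_left _ _
    · obtain ⟨σ, hσ, hzσ⟩ := hatt z.1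
      rw [hzσ] at h1 ⊢
      obtain ⟨τ, hτ, hwτ⟩ := h.exact z w hzw
      rw [nonCollapsed_eq_of_dist_lt hmax haM z.2 hσ h1] at hτ
      refine min_le_min le_rfl ?_
      rw [hwτ, ← dist_permute τ, ← permute_mul, dist_comm]
      exact Metric.infDist_le_dist_of_mem ⟨_, h.trans _ _ _ hσ hτ, rfl⟩
  have key := h.quot.desc (fun z => min M (Metric.infDist z.1 Orb))
    (fun z w hzw => le_antisymm (hmono w z hzw.symm) (hmono z w hzw))
    (fun z w => by
      have h1 := Metric.infDist_le_infDist_add_dist (s := Orb) (x := z.1) (y := w.1)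
      have h2 : dist z w = dist z.1 w.1 := rfl
      have h3 : (0 : ℝ) ≤ dist z.1 w.1 := dist_nonneg
      rw [h2, ← min_add_add_right]
      exact min_le_min (by linarith) h1) z a
  have ha0 : Metric.infDist a.1 Orb = 0 :=
    Metric.infDist_zero_of_mem ⟨1, h.refl F, permute_one _⟩
  have hM : 0 ≤ M := dist_nonneg.trans hd.le
  obtain ⟨σ, hσ, hzσ⟩ := hatt z.1
  simp only [ha0, min_eq_right hM, zero_add] at key
  rw [dist_comm (π z), min_le_iff] at key
  exact ⟨σ, hσ, hzσ ▸ key.resolve_left (not_le.2 hd)⟩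

/-- Take `F` of largest cardinality among the sets that carry a representative of the class. If an
admissible image lay in a larger `F'`, then `F'` would carry the permuted representative. The bound
`k` is kept to secure two edges for TED. -/
theorem exists_isTopologicallyMaximal (h : IsShapeQuotient 𝓔 Adm π) (k : ℕ)
    (z : ↥(restrictedPreShapes 𝓔 : Set (PreShape T d n p)))
    (hz : ∃ F ∈ 𝓔, k ≤ F.card ∧ ∃ w : ↥(restrictedPreShapes 𝓔 : Set (PreShape T d n p)),
      w.1 ∈ supportedOn T d n p F ∧ π w = π z) :
    ∃ F ∈ 𝓔, k ≤ F.card ∧ IsTopologicallyMaximal 𝓔 Adm F ∧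
      ∃ w : ↥(restrictedPreShapes 𝓔 : Set (PreShape T d n p)),
        w.1 ∈ supportedOn T d n p F ∧ π w = π z := by
  obtain ⟨F, ⟨hF, hk, w, hw, hwz⟩, hmax⟩ := Set.exists_max_image
    {F | F ∈ 𝓔 ∧ k ≤ F.card ∧ ∃ w : ↥(restrictedPreShapes 𝓔 : Set (PreShape T d n p)),
      w.1 ∈ supportedOn T d n p F ∧ π w = π z} Finset.card (Set.toFinite _)
    (by obtain ⟨F, h1, h2⟩ := hz; exact ⟨F, h1, h2⟩)
  refine ⟨F, hF, hk, fun σ hσ F' hF' hsub => ?_, w, hw, hwz⟩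
  have hmem := permute_mem_supportedOn hw σ
  have hmem' : permute σ w.1 ∈ supportedOn T d n p F' := fun e he => hmem e fun h' => he (hsub h')
  have hs := h.sound F hF σ hσ w ⟨permute σ w.1, F', hF', hmem'⟩ hw rfl
  have hle := Finset.card_le_card hsub
  rw [Finset.card_map] at hle
  have := hmax F' ⟨hF', hk.trans hle, _, hmem', hs.symm.trans hwz⟩
  exact (Finset.eq_of_subset_of_card_le hsub (by rwa [Finset.card_map])).symm

/-- The quotient map, restricted to the pre-shapes that are supported on `F`. -/
def chart (π : ↥(restrictedPreShapes 𝓔 : Set (PreShape T d n p)) → S) {F : Finset T.Edge}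
    (hF : F ∈ 𝓔) (x : supportedOn T d n p F) : S :=
  π ⟨x.1, F, hF, x.2⟩

theorem IsShapeQuotient.exists_isLocalChart (h : IsShapeQuotient 𝓔 Adm π) {F : Finset T.Edge}
    (hF : F ∈ 𝓔) (hmax : IsTopologicallyMaximal 𝓔 Adm F) (y : supportedOn T d n p F)
    (hy : ∀ e ∈ F, y.1 e ≠ 0) (hinj : ∀ e ∈ F, ∀ f ∈ F, e ≠ f → y.1 e ≠ y.1 f) :
    ∃ R, IsLocalChart (chart π hF) y R := by
  obtain ⟨m, hm, hm1, hm2⟩ : ∃ m > 0, (∀ e ∈ F, m ≤ ‖y.1 e‖) ∧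
      ∀ e ∈ F, ∀ f ∈ F, e ≠ f → m ≤ dist (y.1 e) (y.1 f) := by
    have h1 : ∀ᶠ m : ℝ in 𝓝[>] 0, ∀ e, e ∈ F → m ≤ ‖y.1 e‖ := eventually_all.2 fun e => by
      by_cases he : e ∈ F
      · filter_upwards [Ioo_mem_nhdsGT (norm_pos_iff.2 (hy e he))] with m hm _ using hm.2.le
      · exact Eventually.of_forall fun _ h => absurd h he
    have h2 : ∀ᶠ m : ℝ in 𝓝[>] 0, ∀ e, ∀ f, e ∈ F → f ∈ F → e ≠ f →
        m ≤ dist (y.1 e) (y.1 f) := eventually_all.2 fun e => eventually_all.2 fun f => by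
      by_cases hef : e ∈ F ∧ f ∈ F ∧ e ≠ f
      · filter_upwards [Ioo_mem_nhdsGT (dist_pos.2 (hinj e hef.1 f hef.2.1 hef.2.2))] with m hm
          _ _ _ using hm.2.le
      · exact Eventually.of_forall fun _ h1 h2 h3 => absurd ⟨h1, h2, h3⟩ hef
    obtain ⟨m, hm0, hm1, hm2⟩ := (eventually_mem_nhdsWithin.and (h1.and h2)).exists
    exact ⟨m, hm0, hm1, fun e he f hf => hm2 e f he hf⟩
  -- With radius `m / 8`, images are less than `m / 4` apart and the coordinates of `a` keep norm at
  -- least `m / 4`. A moved edge would force `m ≤ dist (y.1 (σ e)) (y.1 e) < m / 8 + m / 4 + m / 8`.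
  refine ⟨m / 8, by positivity, fun a b ha hb => ?_, fun s hs => ?_⟩
  · refine le_antisymm (h.quot.dist_le _ _) ?_
    have hab : dist (chart π hF a) (chart π hF b) < m / 4 := by
      have h1 : dist (chart π hF a) (chart π hF b) ≤ dist a b := h.quot.dist_le _ _
      have h2 := dist_triangle_right a b y
      linarith
    have hae : ∀ e, dist (a.1 e) (y.1 e) < m / 8 := fun e =>
      (dist_apply_le a.1 y.1 e).trans_lt ha
    have hbe : ∀ e, dist (b.1 e) (y.1 e) < m / 8 := fun e =>
      (dist_apply_le b.1 y.1 e).trans_lt hb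
    have haM : ∀ e ∈ F, m / 4 ≤ ‖a.1 e‖ := fun e he => by
      have h1 := hm1 e he
      have h2 := hae e
      have h3 := norm_sub_norm_le (y.1 e) (a.1 e)
      rw [← dist_eq_norm, dist_comm] at h3
      linarith
    obtain ⟨σ, hσ, hd⟩ := h.exists_dist_permute_le hmax
      (a := ⟨a.1, F, hF, a.2⟩) (z := ⟨b.1, F, hF, b.2⟩) haM hab
    have hsupp := nonCollapsed_eq_of_dist_lt hmax haM ⟨F, hF, b.2⟩ hσ (hd.trans_lt hab)
    have hmapF : ∀ e ∈ F, σ e ∈ F := by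
      intro e he
      have h1 : σ e ∈ nonCollapsed b.1 := by
        rw [hsupp]
        exact Finset.mem_map_of_mem _ he
      by_contra h2
      exact mem_nonCollapsed.1 h1 (b.2 _ h2)
    have hfix : ∀ e ∈ F, σ e = e := by
      intro e he
      by_contra hne
      have h1 := hm2 (σ e) (hmapF e he) e he hne
      have h2 := (dist_apply_le _ _ (σ e)).trans_lt (hd.trans_lt hab)
      simp only [permute_apply, Equiv.symm_apply_apply] at h2
      have h3 := hae e
      have h4 := hbe (σ e)
      have h5 := dist_triangle (y.1 (σ e)) (b.1 (σ e)) (y.1 e)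
      have h6 := dist_triangle (b.1 (σ e)) (a.1 e) (y.1 e)
      rw [dist_comm (y.1 (σ e)) (b.1 (σ e))] at h5
      rw [dist_comm (b.1 (σ e)) (a.1 e)] at h6
      linarith
    -- Outside `F` the permutation may be arbitrary, but it only moves zeros.
    have hσa : permute σ a.1 = a.1 := by
      ext e : 1
      rw [permute_apply]
      by_cases he : e ∈ F
      · rw [← hfix e he, Equiv.symm_apply_apply, hfix e he]
      · rw [a.2 e he]
        refine a.2 _ fun h' => he ?_
        simpa using hmapF _ h'
    rw [hσa] at hd
    exact hd
  · obtain ⟨z, rfl⟩ := h.quot.surj s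
    rw [dist_comm] at hs
    obtain ⟨σ, hσ, hd⟩ := h.exists_dist_permute_le hmax (a := ⟨y.1, F, hF, y.2⟩) (z := z) hm1
      (hs.trans (by linarith))
    have hlt := hd.trans_lt hs
    have hsupp := nonCollapsed_eq_of_dist_lt hmax hm1 z.2 hσ (hlt.trans (by linarith))
    have hmem : permute σ.symm z.1 ∈ supportedOn T d n p F := by
      intro e he
      by_contra h0
      have h1 : σ e ∈ nonCollapsed z.1 := mem_nonCollapsed.2 h0
      rw [hsupp, Finset.mem_map_equiv, Equiv.symm_apply_apply] at h1
      exact he h1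
    refine ⟨⟨_, hmem⟩, ?_, ?_⟩
    · change dist (permute σ.symm z.1) y.1 < m / 8
      rwa [← dist_permute σ, permute_permute_symm, dist_comm]
    · exact h.sound F hF σ hσ _ z hmem (permute_permute_symm _ _).symm

end Shapes

end TreeShape

namespace TreeShape

/-! ### Ordered and unordered shapes as permutation quotients -/

section Instances

variable {T : OrderedBinaryTree} {d n : ℕ} {p : ℝ≥0∞}

/-- `σ` maps `F` to its image as an isomorphism of ordered trees. -/
def OrderedAdm (F : Finset T.Edge) (σ : Equiv.Perm T.Edge) : Prop :=
  ∀ e ∈ F, ∀ f ∈ F, (Anc (σ e) (σ f) ↔ Anc e f) ∧ (DepthFirstLT (σ e) (σ f) ↔ DepthFirstLT e f)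

theorem OrderedAdm.refl (F : Finset T.Edge) : OrderedAdm F 1 :=
  fun _ _ _ _ => ⟨Iff.rfl, Iff.rfl⟩

theorem OrderedAdm.trans {F : Finset T.Edge} {σ τ : Equiv.Perm T.Edge} (hσ : OrderedAdm F σ)
    (hτ : OrderedAdm (F.map σ.toEmbedding) τ) : OrderedAdm F (τ * σ) := fun e he f hf => by
  have h := hτ _ (Finset.mem_map_of_mem _ he) _ (Finset.mem_map_of_mem _ hf)
  exact ⟨h.1.trans (hσ e he f hf).1, h.2.trans (hσ e he f hf).2⟩

theorem OrderedAdm.symm {F : Finset T.Edge} {σ : Equiv.Perm T.Edge} (hσ : OrderedAdm F σ) :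
    OrderedAdm (F.map σ.toEmbedding) σ.symm := fun e he f hf => by
  have h := hσ _ (Finset.mem_map_equiv.1 he) _ (Finset.mem_map_equiv.1 hf)
  simp only [Equiv.apply_symm_apply] at h
  exact ⟨h.1.symm, h.2.symm⟩

theorem OrderedAdm.sameTopology {F : Finset T.Edge} {σ : Equiv.Perm T.Edge}
    (hσ : OrderedAdm F σ) : SameTopology F (F.map σ.toEmbedding) :=
  ⟨σ.subtypeEquiv (p := (· ∈ F)) (q := (· ∈ F.map σ.toEmbedding)) fun e => by simp,
    fun e f => hσ e e.2 f f.2⟩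

/-- A bijection between two subsets of a finite set extends to a permutation; off the supports both
attributes vanish. -/
theorem SameShape.exists_orderedAdm {z w : PreShape T d n p} (h : SameShape z w) :
    ∃ σ, OrderedAdm (nonCollapsed z) σ ∧ w = permute σ z := by
  obtain ⟨φ, hφ, hw⟩ := h
  have hval : ∀ e (he : e ∈ nonCollapsed z), φ.extendSubtype e = (φ ⟨e, he⟩).1 :=
    fun e he => φ.extendSubtype_apply_of_mem e he
  refine ⟨φ.extendSubtype, fun e he f hf => ?_, ?_⟩
  · rw [hval e he, hval f hf]
    exact hφ ⟨e, he⟩ ⟨f, hf⟩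
  · ext e : 1
    obtain ⟨f, rfl⟩ := φ.extendSubtype.surjective e
    rw [permute_apply, Equiv.symm_apply_apply]
    by_cases hf : f ∈ nonCollapsed z
    · rw [hval f hf, hw]
    · have h1 := φ.extendSubtype_not_mem f hf
      rw [mem_nonCollapsed, not_not] at hf h1
      rw [hf, h1]

theorem OrderedAdm.sameShape {F : Finset T.Edge} {σ : Equiv.Perm T.Edge} (hσ : OrderedAdm F σ)
    {z : PreShape T d n p} (hz : z ∈ supportedOn T d n p F) : SameShape z (permute σ z) := by
  have hzF : ∀ e ∈ nonCollapsed z, e ∈ F := fun e he => by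
    by_contra h
    exact mem_nonCollapsed.1 he (hz e h)
  refine ⟨σ.subtypeEquiv (p := (· ∈ nonCollapsed z)) (q := (· ∈ nonCollapsed (permute σ z)))
    fun e => by simp [mem_nonCollapsed], fun e f => hσ e (hzF e e.2) f (hzF f f.2), fun e => ?_⟩
  simp

/-- The class of a pre-shape in the space of ordered tree-shapes. -/
def toOrdered (Z : Set (PreShape T d n p)) (z : Z) : OrderedShape Z := Quotient.mk (shapeSetoid Z) z

/-- The class of an ordered tree-shape in the space of unordered tree-shapes. -/
def toUnordered (Z : Set (PreShape T d n p)) (a : OrderedShape Z) : UnorderedShape Z :=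
  Quotient.mk (reorderSetoid Z) a

theorem toOrdered_eq_of_sameShape {Z : Set (PreShape T d n p)} {z w : Z}
    (h : SameShape z.1 w.1) : toOrdered Z z = toOrdered Z w :=
  Quotient.sound (s := shapeSetoid Z) h

theorem isMetricQuotientMap_toOrdered [Fact (1 ≤ p)] (Z : Set (PreShape T d n p)) :
    IsMetricQuotientMap (toOrdered Z) :=
  isMetricQuotientMap_mk (shapeSetoid Z)

theorem isMetricQuotientMap_toUnordered [Fact (1 ≤ p)] (Z : Set (PreShape T d n p)) :
    IsMetricQuotientMap (toUnordered Z) :=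
  isMetricQuotientMap_mk (reorderSetoid Z)

theorem isShapeQuotient_toOrdered [Fact (1 ≤ p)] {𝓔 : Set (Finset T.Edge)}
    (h𝓔 : ContainsAllRepresentations 𝓔) :
    IsShapeQuotient 𝓔 OrderedAdm (toOrdered (restrictedPreShapes 𝓔 : Set (PreShape T d n p))) where
  quot := isMetricQuotientMap_toOrdered _
  refl := OrderedAdm.refl
  trans _ _ _ hσ hτ := hσ.trans hτ
  closed F hF _ hσ := h𝓔 F hF _ hσ.sameTopology
  exact _ _ hzw := SameShape.exists_orderedAdm (Quotient.exact hzw)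
  sound _ _ _ hσ _ _ hz hw := toOrdered_eq_of_sameShape (hw ▸ hσ.sameShape hz)

/-- The bijections that are composed of reorderings and isomorphisms of ordered trees. -/
inductive UnorderedAdm : Finset T.Edge → Equiv.Perm T.Edge → Prop
  | ordered {F σ} (h : OrderedAdm F σ) : UnorderedAdm F σ
  | reorder (F) (g : Reordering T) : UnorderedAdm F g.toEquiv
  | trans {F σ τ} (hσ : UnorderedAdm F σ) (hτ : UnorderedAdm (F.map σ.toEmbedding) τ) :
    UnorderedAdm F (τ * σ)

theorem map_mul (F : Finset T.Edge) (σ τ : Equiv.Perm T.Edge) :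
    F.map (τ * σ).toEmbedding = (F.map σ.toEmbedding).map τ.toEmbedding := by
  rw [Finset.map_map]
  rfl

theorem map_map_symm (F : Finset T.Edge) (σ : Equiv.Perm T.Edge) :
    (F.map σ.toEmbedding).map σ.symm.toEmbedding = F := by
  ext e
  simp [Finset.mem_map_equiv]

theorem UnorderedAdm.symm {F : Finset T.Edge} {σ : Equiv.Perm T.Edge} (h : UnorderedAdm F σ) :
    UnorderedAdm (F.map σ.toEmbedding) σ.symm := by
  induction h with
  | ordered h => exact .ordered h.symm
  | reorder F g => exact .reorder _ g.symm
  | @trans F σ τ _ _ ihσ ihτ =>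
    rw [map_mul]
    refine UnorderedAdm.trans ihτ ?_
    rw [map_map_symm]
    exact ihσ

theorem UnorderedAdm.closed {𝓔 : Set (Finset T.Edge)} (h𝓔 : ContainsAllRepresentations 𝓔)
    (hsat : ReorderingSaturated 𝓔) {F : Finset T.Edge} {σ : Equiv.Perm T.Edge}
    (h : UnorderedAdm F σ) (hF : F ∈ 𝓔) : F.map σ.toEmbedding ∈ 𝓔 := by
  induction h with
  | ordered h => exact h𝓔 _ hF _ h.sameTopology
  | reorder F g => exact hsat _ hF g
  | trans _ _ ihσ ihτ =>
    rw [map_mul]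
    exact ihτ (ihσ hF)

theorem UnorderedAdm.sound {𝓔 : Set (Finset T.Edge)} (h𝓔 : ContainsAllRepresentations 𝓔)
    (hsat : ReorderingSaturated 𝓔) {F : Finset T.Edge} {σ : Equiv.Perm T.Edge}
    (h : UnorderedAdm F σ) (hF : F ∈ 𝓔)
    (z w : ↥(restrictedPreShapes 𝓔 : Set (PreShape T d n p)))
    (hz : z.1 ∈ supportedOn T d n p F) (hw : w.1 = permute σ z.1) :
    toUnordered _ (toOrdered _ z) = toUnordered _ (toOrdered _ w) := by
  induction h generalizing z w with
  | ordered h =>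
    refine congrArg _ (toOrdered_eq_of_sameShape ?_)
    rw [hw]
    exact h.sameShape hz
  | reorder F g =>
    exact Quotient.sound (Relation.EqvGen.rel _ _ ⟨g, z, w, hw, rfl, rfl⟩)
  | @trans F σ τ hσ _ ihσ ihτ =>
    -- The intermediate pre-shape must again lie in the restricted space; this is where both closure
    -- properties of `𝓔` enter.
    have hσF := hσ.closed h𝓔 hsat hF
    have hmem := permute_mem_supportedOn hz σ
    rw [ihσ hF z ⟨_, mem_restrictedPreShapes_of_mem_supportedOn hσF hmem⟩ hz rfl]
    exact ihτ hσF _ w hmem hw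

/-- The induction runs over classes, so the claim is made for all representatives; changing a
representative costs one more ordered isomorphism. -/
theorem exists_unorderedAdm_of_eqvGen {Z : Set (PreShape T d n p)} {a b : OrderedShape Z}
    (h : Relation.EqvGen (fun a b => ∃ (g : Reordering T) (x y : Z), y.1 = reorder g x.1 ∧
      Quotient.mk (shapeSetoid Z) x = a ∧ Quotient.mk (shapeSetoid Z) y = b) a b) :
    ∀ z w : Z, toOrdered Z z = a → toOrdered Z w = b →
      ∃ σ, UnorderedAdm (nonCollapsed z.1) σ ∧ w.1 = permute σ z.1 := by
  have hord : ∀ z w : Z, toOrdered Z z = toOrdered Z w →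
      ∃ σ, UnorderedAdm (nonCollapsed z.1) σ ∧ w.1 = permute σ z.1 := fun z w hzw => by
    obtain ⟨σ, hσ, hw⟩ := SameShape.exists_orderedAdm
      (show SameShape z.1 w.1 from Quotient.exact hzw)
    exact ⟨σ, .ordered hσ, hw⟩
  have hcomp : ∀ x z w : Z, (∃ σ, UnorderedAdm (nonCollapsed x.1) σ ∧ z.1 = permute σ x.1) →
      (∃ σ, UnorderedAdm (nonCollapsed z.1) σ ∧ w.1 = permute σ z.1) →
      ∃ σ, UnorderedAdm (nonCollapsed x.1) σ ∧ w.1 = permute σ x.1 := by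
    rintro x z w ⟨σ, hσ, hz⟩ ⟨τ, hτ, hw⟩
    rw [hz, nonCollapsed_permute] at hτ
    exact ⟨τ * σ, hσ.trans hτ, by rw [hw, hz, permute_mul]⟩
  induction h with
  | rel a b h =>
    obtain ⟨g, x, y, hyx, rfl, rfl⟩ := h
    intro z w hz hw
    exact hcomp _ _ _ (hord z x hz) (hcomp _ _ _ ⟨_, .reorder _ g, hyx⟩ (hord y w hw.symm))
  | refl a => exact fun z w hz hw => hord z w (hz.trans hw.symm)
  | symm a b _ ih =>
    intro z w hz hw
    obtain ⟨σ, hσ, hz'⟩ := ih w z hw hz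
    refine ⟨σ.symm, ?_, ?_⟩
    · rw [hz', nonCollapsed_permute]
      exact hσ.symm
    · rw [hz', permute_symm_permute]
  | trans a b c _ _ ih₁ ih₂ =>
    intro z w hz hw
    obtain ⟨x, rfl⟩ := Quotient.mk_surjective b
    exact hcomp _ _ _ (ih₁ z x hz rfl) (ih₂ x w rfl hw)

theorem isShapeQuotient_toUnordered [Fact (1 ≤ p)] {𝓔 : Set (Finset T.Edge)}
    (h𝓔 : ContainsAllRepresentations 𝓔) (hsat : ReorderingSaturated 𝓔) :
    IsShapeQuotient 𝓔 UnorderedAdm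
      (toUnordered _ ∘ toOrdered (restrictedPreShapes 𝓔 : Set (PreShape T d n p))) where
  quot := (isMetricQuotientMap_toUnordered _).comp (isMetricQuotientMap_toOrdered _)
  refl F := .ordered (.refl F)
  trans _ _ _ hσ hτ := hσ.trans hτ
  closed _ hF _ hσ := hσ.closed h𝓔 hsat hF
  exact z w hzw := exists_unorderedAdm_of_eqvGen (Quotient.exact hzw) z w rfl rfl
  sound _ hF _ hσ z w hz hw := hσ.sound h𝓔 hsat hF z w hz hw

end Instances

/-! ### Density of charts and the two theorems -/

section Generic

variable {T : OrderedBinaryTree} {d n : ℕ} {p : ℝ≥0∞}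

theorem restrictedPreShapes_univ :
    (restrictedPreShapes Set.univ : Set (PreShape T d n p)) = Set.univ :=
  Set.eq_univ_of_forall fun _ => ⟨Finset.univ, trivial, fun _ h => absurd (Finset.mem_univ _) h⟩

/-- If some set in `𝓔` has two elements, then every shape is represented on such a set. -/
theorem exists_two_le_card {𝓔 : Set (Finset T.Edge)} (htwo : ∃ F ∈ 𝓔, 2 ≤ F.card)
    (z : ↥(restrictedPreShapes 𝓔 : Set (PreShape T d n p))) :
    ∃ F ∈ 𝓔, 2 ≤ F.card ∧ ∃ w : ↥(restrictedPreShapes 𝓔 : Set (PreShape T d n p)),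
      w.1 ∈ supportedOn T d n p F ∧ toOrdered _ w = toOrdered _ z := by
  classical
  obtain ⟨F, hF, hFcard⟩ := htwo
  obtain ⟨F', hF', hzF'⟩ := z.2
  rcases Nat.lt_or_ge F'.card 2 with hlt | hge
  · rcases Nat.lt_or_ge F'.card 1 with h0 | h1
    · have : F' = ∅ := Finset.card_eq_zero.1 (by omega)
      exact ⟨F, hF, hFcard, z, fun e _ => hzF' e (by simp [this]), rfl⟩
    · obtain ⟨e, rfl⟩ := Finset.card_eq_one.1 (show F'.card = 1 by omega)
      obtain ⟨f, hf⟩ := Finset.card_pos.1 (show 0 < F.card by omega)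
      -- All one-edge trees have the same topology, so the single edge can be moved into `F`.
      have hadm : OrderedAdm {e} (Equiv.swap e f) := by
        intro a ha b hb
        rw [Finset.mem_singleton] at ha hb
        subst ha hb
        simp [Anc, DepthFirstLT]
      have hz : z.1 ∈ supportedOn T d n p {e} := hzF'
      have hshape : SameShape z.1 (permute (Equiv.swap e f) z.1) := hadm.sameShape hz
      have hmem : permute (Equiv.swap e f) z.1 ∈ supportedOn T d n p F := fun a ha =>
        permute_mem_supportedOn hz _ a (by
          simp only [Finset.map_singleton, Equiv.coe_toEmbedding, Equiv.swap_apply_left,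
            Finset.mem_singleton]
          rintro rfl
          exact ha hf)
      exact ⟨F, hF, hFcard, ⟨_, F, hF, hmem⟩, hmem,
        (toOrdered_eq_of_sameShape hshape).symm⟩
  · exact ⟨F', hF', hge, z, hzF', rfl⟩

theorem eventually_add_smul_ne_zero {W : Type*} [NormedAddCommGroup W] [NormedSpace ℝ W] (z : W)
    {w : W} (hw : w ≠ 0) : ∀ᶠ t : ℝ in 𝓝[>] 0, z + t • w ≠ 0 := by
  by_cases hz : z = 0
  · filter_upwards [self_mem_nhdsWithin] with t ht
    rw [hz, zero_add]
    exact smul_ne_zero (ne_of_gt ht) hw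
  · have h1 : Continuous fun t : ℝ => z + t • w := by fun_prop
    have h2 := h1.tendsto 0
    rw [zero_smul, add_zero] at h2
    exact nhdsWithin_le_nhds (h2.eventually (isOpen_ne.mem_nhds hz))

/-- Move `z` along a direction whose coordinates are distinct nonzero multiples of one vector; each
of the finitely many unwanted equalities fails for all small `t > 0`. -/
theorem exists_generic_near [Fact (1 ≤ p)] (hd : 1 ≤ d) (hn : 1 ≤ n) {F : Finset T.Edge}
    (z : supportedOn T d n p F) {ε : ℝ} (hε : 0 < ε) :
    ∃ y : supportedOn T d n p F, dist y z < ε ∧ (∀ e ∈ F, y.1 e ≠ 0) ∧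
      ∀ e ∈ F, ∀ f ∈ F, e ≠ f → y.1 e ≠ y.1 f := by
  classical
  have : Nonempty (Fin d) := ⟨⟨0, hd⟩⟩
  have : Nonempty (Fin n) := ⟨⟨0, hn⟩⟩
  obtain ⟨w, hw⟩ := exists_ne (0 : PiLp 2 fun _ : Fin n => EuclideanSpace ℝ (Fin d))
  set c : T.Edge → ℝ := fun e => (Fintype.equivFin T.Edge e : ℕ) + 1 with hc
  have hc0 : ∀ e, c e ≠ 0 := fun e => by positivity
  have hcinj : ∀ e f, e ≠ f → c e - c f ≠ 0 := fun e f hef h => hef <| by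
    have : ((Fintype.equivFin T.Edge e : ℕ) : ℝ) = (Fintype.equivFin T.Edge f : ℕ) := by
      simp only [hc] at h
      linarith
    exact (Fintype.equivFin T.Edge).injective (Fin.ext (Nat.cast_injective this))
  set v : supportedOn T d n p F :=
    ⟨WithLp.toLp p fun e => if e ∈ F then c e • w else 0, fun e he => by simp [he]⟩ with hv
  have hve : ∀ e ∈ F, v.1 e = c e • w := fun e he => by simp [hv, he]
  have h1 : ∀ᶠ t : ℝ in 𝓝[>] 0, dist (z + t • v) z < ε := by
    filter_upwards [Ioo_mem_nhdsGT (show 0 < ε / (‖v‖ + 1) by positivity)] with t ht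
    rw [dist_self_add_left, norm_smul, Real.norm_of_nonneg ht.1.le]
    have h2 := (lt_div_iff₀ (by positivity)).1 ht.2
    linarith [ht.1]
  have h2 : ∀ᶠ t : ℝ in 𝓝[>] 0, ∀ e, e ∈ F → (z + t • v).1 e ≠ 0 :=
    eventually_all.2 fun e => by
      filter_upwards [eventually_add_smul_ne_zero (z.1 e) (smul_ne_zero (hc0 e) hw)] with t ht he
      have : (z + t • v).1 e = z.1 e + t • v.1 e := rfl
      rwa [this, hve e he]
  have h3 : ∀ᶠ t : ℝ in 𝓝[>] 0, ∀ e f, e ∈ F → f ∈ F → e ≠ f →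
      (z + t • v).1 e ≠ (z + t • v).1 f :=
    eventually_all.2 fun e => eventually_all.2 fun f => by
      by_cases hef : e = f
      · exact Eventually.of_forall fun _ _ _ h => absurd hef h
      filter_upwards [eventually_add_smul_ne_zero (z.1 e - z.1 f)
        (smul_ne_zero (hcinj e f hef) hw)] with t ht he hf _ heq
      have h1 : (z + t • v).1 e = z.1 e + t • v.1 e := rfl
      have h2 : (z + t • v).1 f = z.1 f + t • v.1 f := rfl
      rw [h1, h2, hve e he, hve f hf, ← sub_eq_zero] at heq
      refine ht (Eq.trans ?_ heq)
      module
  obtain ⟨t, ht1, ht2, ht3⟩ := (h1.and (h2.and h3)).exists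
  exact ⟨z + t • v, ht1, ht2, fun e he f hf => ht3 e f he hf⟩

variable [Fact (1 ≤ p)] {S : Type*} [PseudoMetricSpace S]
  {𝓔 : Set (Finset T.Edge)} {Adm : Finset T.Edge → Equiv.Perm T.Edge → Prop}
  {π : ↥(restrictedPreShapes 𝓔 : Set (PreShape T d n p)) → S}

theorem IsShapeQuotient.exists_chart_near (h : IsShapeQuotient 𝓔 Adm π) (hd : 1 ≤ d) (hn : 1 ≤ n)
    (k : ℕ) (z : ↥(restrictedPreShapes 𝓔 : Set (PreShape T d n p)))
    (hz : ∃ F ∈ 𝓔, k ≤ F.card ∧ ∃ w : ↥(restrictedPreShapes 𝓔 : Set (PreShape T d n p)),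
      w.1 ∈ supportedOn T d n p F ∧ π w = π z) {ε : ℝ} (hε : 0 < ε) :
    ∃ (F : Finset T.Edge) (hF : F ∈ 𝓔), k ≤ F.card ∧ ∃ (y : supportedOn T d n p F) (R : ℝ),
      IsLocalChart (chart π hF) y R ∧ dist (chart π hF y) (π z) < ε := by
  obtain ⟨F, hF, hk, hmax, w, hw, hwz⟩ := exists_isTopologicallyMaximal h k z hz
  obtain ⟨y, hyw, hy0, hyinj⟩ := exists_generic_near hd hn ⟨w.1, hw⟩ hε
  obtain ⟨R, hR⟩ := h.exists_isLocalChart hF hmax y hy0 hyinj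
  refine ⟨F, hF, hk, y, R, hR, ?_⟩
  rw [← hwz]
  exact (h.quot.dist_le _ _).trans_lt hyw

theorem IsShapeQuotient.genericallyUniqueAverages
    {π : ↥(restrictedPreShapes 𝓔 : Set (PreShape T d n 2)) → S}
    (h : IsShapeQuotient 𝓔 Adm π) (hd : 1 ≤ d) (hn : 1 ≤ n) : GenericallyUniqueAverages S := by
  refine genericallyUniqueAverages_of_dense fun s ε hε => ?_
  obtain ⟨z, rfl⟩ := h.quot.surj s
  obtain ⟨F, hF, hzF⟩ := z.2
  obtain ⟨F, hF, -, y, R, hR, hdist⟩ :=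
    h.exists_chart_near hd hn 0 z ⟨F, hF, Nat.zero_le _, z, hzF, rfl⟩ hε
  exact ⟨_, hdist, hR.exists_isGoodNhd⟩

/-- Unit attributes placed on two different edges of `F` span an ℓ¹ plane. -/
theorem exists_orthogonal_edges (hd : 1 ≤ d) (hn : 1 ≤ n) {F : Finset T.Edge} (hF : 2 ≤ F.card) :
    ∃ v w : supportedOn T d n 1 F, ∀ α β : ℝ, ‖α • v + β • w‖ = |α| + |β| := by
  classical
  have : Nonempty (Fin d) := ⟨⟨0, hd⟩⟩
  have : Nonempty (Fin n) := ⟨⟨0, hn⟩⟩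
  obtain ⟨e, he, f, hf, hef⟩ := Finset.one_lt_card.1 hF
  obtain ⟨u, hu⟩ := exists_norm_eq (PiLp 2 fun _ : Fin n => EuclideanSpace ℝ (Fin d))
    zero_le_one
  have hmem : ∀ e ∈ F, (PiLp.single 1 e u : PreShape T d n 1) ∈ supportedOn T d n 1 F :=
    fun e he e' he' => by
      rw [PiLp.single_apply, if_neg]
      rintro rfl
      exact he' he
  refine ⟨⟨_, hmem e he⟩, ⟨_, hmem f hf⟩, fun α β => ?_⟩
  change ‖α • (PiLp.single 1 e u : PreShape T d n 1) + β • PiLp.single 1 f u‖ = _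
  rw [PiLp.norm_eq_of_L1, ← Finset.add_sum_erase _ _ (Finset.mem_univ e),
    ← Finset.add_sum_erase _ _ (Finset.mem_erase.2 ⟨hef.symm, Finset.mem_univ f⟩),
    Finset.sum_eq_zero, add_zero]
  · simp [hef, hef.symm, norm_smul, hu]
  · intro e' he'
    have h1 := (Finset.mem_erase.1 he').1
    have h2 := (Finset.mem_erase.1 (Finset.mem_erase.1 he').2).1
    simp [h1, h2]

theorem IsShapeQuotient.nowhereUniqueAverages
    {π : ↥(restrictedPreShapes 𝓔 : Set (PreShape T d n 1)) → S}
    (h : IsShapeQuotient 𝓔 Adm π) (hd : 1 ≤ d) (hn : 1 ≤ n)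
    (htwo : ∀ z : ↥(restrictedPreShapes 𝓔 : Set (PreShape T d n 1)), ∃ F ∈ 𝓔, 2 ≤ F.card ∧
      ∃ w : ↥(restrictedPreShapes 𝓔 : Set (PreShape T d n 1)),
        w.1 ∈ supportedOn T d n 1 F ∧ π w = π z) :
    NowhereUniqueAverages S := by
  intro s U hU
  obtain ⟨z, rfl⟩ := h.quot.surj s
  obtain ⟨ε, hε, hεU⟩ := Metric.mem_nhds_iff.1 hU
  obtain ⟨F, hF, hk, y, R, hR, hdist⟩ := h.exists_chart_near hd hn 2 z (htwo z) hε
  obtain ⟨v, w, hvw⟩ := exists_orthogonal_edges hd hn hk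
  exact hR.exists_nonunique hvw
    (mem_of_superset (Metric.isOpen_ball.mem_nhds (Metric.mem_ball.2 hdist)) hεU)

theorem averages_restricted (hd : 1 ≤ d) (hn : 1 ≤ n) (h𝓔 : ContainsAllRepresentations 𝓔) :
    GenericallyUniqueAverages (OrderedShape
        (restrictedPreShapes 𝓔 : Set (PreShape T d n 2))) ∧
      ((∃ F ∈ 𝓔, 2 ≤ F.card) → NowhereUniqueAverages (OrderedShape
        (restrictedPreShapes 𝓔 : Set (PreShape T d n 1)))) ∧
      (ReorderingSaturated 𝓔 →
        GenericallyUniqueAverages (UnorderedShape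
          (restrictedPreShapes 𝓔 : Set (PreShape T d n 2))) ∧
        ((∃ F ∈ 𝓔, 2 ≤ F.card) → NowhereUniqueAverages (UnorderedShape
          (restrictedPreShapes 𝓔 : Set (PreShape T d n 1))))) := by
  refine ⟨(isShapeQuotient_toOrdered h𝓔).genericallyUniqueAverages hd hn, fun htwo =>
    (isShapeQuotient_toOrdered h𝓔).nowhereUniqueAverages hd hn (exists_two_le_card htwo),
    fun hsat => ⟨(isShapeQuotient_toUnordered h𝓔 hsat).genericallyUniqueAverages hd hn,
      fun htwo => (isShapeQuotient_toUnordered h𝓔 hsat).nowhereUniqueAverages hd hn fun z => ?_⟩⟩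
  obtain ⟨F, hF, hk, w, hw, hwz⟩ := exists_two_le_card htwo z
  exact ⟨F, hF, hk, w, hw, congrArg (toUnordered _) hwz⟩

end Generic

end TreeShape

theorem mainTheorem3 (T : TreeShape.OrderedBinaryTree) (d n : ℕ) (hd : 1 ≤ d) (hn : 1 ≤ n) :
    -- the QED metric on the ordered and on the unordered tree-shape space
    (TreeShape.GenericallyUniqueAverages
        (TreeShape.OrderedShape (Set.univ : Set (TreeShape.PreShape T d n 2))) ∧
      TreeShape.GenericallyUniqueAverages
        (TreeShape.UnorderedShape (Set.univ : Set (TreeShape.PreShape T d n 2)))) ∧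
    -- the TED metric on the ordered and on the unordered tree-shape space
    (2 ≤ Fintype.card T.Edge →
      TreeShape.NowhereUniqueAverages
        (TreeShape.OrderedShape (Set.univ : Set (TreeShape.PreShape T d n 1))) ∧
      TreeShape.NowhereUniqueAverages
        (TreeShape.UnorderedShape (Set.univ : Set (TreeShape.PreShape T d n 1)))) ∧
    -- the restricted spaces
    (∀ 𝓔 : Set (Finset T.Edge), TreeShape.ContainsAllRepresentations 𝓔 →
      TreeShape.GenericallyUniqueAverages (TreeShape.OrderedShape
        (TreeShape.restrictedPreShapes 𝓔 : Set (TreeShape.PreShape T d n 2))) ∧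
      ((∃ F ∈ 𝓔, 2 ≤ F.card) → TreeShape.NowhereUniqueAverages (TreeShape.OrderedShape
        (TreeShape.restrictedPreShapes 𝓔 : Set (TreeShape.PreShape T d n 1)))) ∧
      (TreeShape.ReorderingSaturated 𝓔 →
        TreeShape.GenericallyUniqueAverages (TreeShape.UnorderedShape
          (TreeShape.restrictedPreShapes 𝓔 : Set (TreeShape.PreShape T d n 2))) ∧
        ((∃ F ∈ 𝓔, 2 ≤ F.card) → TreeShape.NowhereUniqueAverages (TreeShape.UnorderedShape
          (TreeShape.restrictedPreShapes 𝓔 : Set (TreeShape.PreShape T d n 1)))))) := by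

  refine ⟨?_, fun hcard => ?_, fun 𝓔 h𝓔 => TreeShape.averages_restricted hd hn h𝓔⟩
  -- The full spaces are the restricted ones for the family of all edge sets, which is trivially
  -- closed.
  · have h := TreeShape.averages_restricted (T := T) (d := d) (n := n) (𝓔 := Set.univ) hd hn
      fun _ _ _ _ => trivial
    rw [TreeShape.restrictedPreShapes_univ, TreeShape.restrictedPreShapes_univ] at h
    exact ⟨h.1, (h.2.2 fun _ _ _ => trivial).1⟩
  · have h := TreeShape.averages_restricted (T := T) (d := d) (n := n) (𝓔 := Set.univ) hd hn
      fun _ _ _ _ => trivial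
    rw [TreeShape.restrictedPreShapes_univ, TreeShape.restrictedPreShapes_univ] at h
    have htwo : ∃ F ∈ (Set.univ : Set (Finset T.Edge)), 2 ≤ F.card :=
      ⟨Finset.univ, trivial, by rwa [Finset.card_univ]⟩
    exact ⟨h.2.1 htwo, (h.2.2 fun _ _ _ => trivial).2 htwo⟩
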